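/- **Notation.** Let $S_n$ be the symmetric group on $[n]=\{1,\dots,n\}$, with simple transpositions $s_i=(i,i+1)$ for $1\le i\le n-1$, transpositions $t_{ij}=(i,j)$ (with $t_{ii}=e$), product given by composition of functions (so $wt_{ij}$ is $w$ with the values in positions $i,j$ exchanged), and length $\ell(w)$, the least number of factors in an expression of $w$ as a product of simple transpositions. A reduced word of $w$ is a word $(a_1,\dots,a_p)$ with $w=s_{a_1}\cdots s_{a_p}$ and $p=\ell(w)$. Write $v\lessdot w$ if $w=vt_{ij}$ for some $i\neq j$ and $\ell(w)=\ell(v)+1$. Let $\circ$ be the 0-Hecke product: $w\circ s_i=ws_i$ if $w\lessdot ws_i$ and $w\circ s_i=w$ otherwise; likewise $s_i\circ w=s_iw$ if $w\lessdot s_iw$ and $s_i\circ w=w$ otherwise. Let $\mu=(\mu_1,\dots,\mu_k)$ be a composition of $n$ and $m_b=\mu_1+\dots+\mu_{b-1}$. For $\pi\in S_n$ the $b$-th block is the word $B_b=\pi(m_b+1)\cdots\pi(m_b+\mu_b)$, and its standardization $\mathrm{std}(B_b)\in S_{\mu_b}$ is the permutation in the same relative order. Call $\pi$ a $\mu$-involution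 if $\mathrm{std}(B_b)^2=e$ for every $b$, and let $\mathcal I_\mu$ be the set of $\mu$-involutions. Put $$\pi\circ_\mu s_i=\begin{cases}s_i\circ\pi & \text{if the values } i,i+1 \text{ lie in different blocks of } \pi,\\ (s_i\circ\pi)\circ s_{m_b+r} & \text{if the values } i,i+1 \text{ lie in the same block } B_b,\end{cases}$$ where $r$ is the rank of the value $i$ among the letters of $B_b$. A $\mu$-word for $\pi\in\mathcal I_\mu$ is a word $(a_1,\dots,a_p)$ with $\pi=(\cdots((e\circ_\mu s_{a_1})\circ_\mu s_{a_2})\cdots)\circ_\mu s_{a_p}$; it is reduced if $p$ is minimal. The set $\mathcal A_\mu(\pi)$ of $\mu$-atoms of $\pi$ consists of the $w\in S_n$ that have a reduced word which is a reduced $\mu$-word for $\pi$. For $i,j\in[n]$ the operator $t^\mu_{ij}$ on $\mathcal I_\mu$ is defined as follows: if there are $v\in\mathcal A_\mu(\pi)$ and $\tau\in\mathcal I_\mu$ with $v\lessdot vt_{ij}$ and $vt_{ij}\in\mathcal A_\mu(\tau)$, then $t^\mu_{ij}(\pi)=\tau$; otherwise $t^\mu_{ij}(\pi)=\pi$. **Lemma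 3.8.** For every composition $\mu$ of $n$ and all $i,j\in[n]$, the operator $t^\mu_{ij}:\mathcal I_\mu\to\mathcal I_\mu$ is well defined, that is, the rule above assigns exactly one $\mu$-involution to each $\pi\in\mathcal I_\mu$. In particular, if $\pi,\sigma,\tau\in\mathcal I_\mu$ and $u,v\in\mathcal A_\mu(\pi)$ satisfy $u\lessdot ut_{ij}$, $v\lessdot vt_{ij}$, $ut_{ij}\in\mathcal A_\mu(\sigma)$ and $vt_{ij}\in\mathcal A_\mu(\tau)$, then $\sigma=\tau$. -/

import Mathlib

namespace MuInv

/-! Permutations of `{1, …, n}` are elements of `Equiv.Perm (Fin n)`, with values and positions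
shifted down by one.  The product `u * v` is composition of functions, so that
`w * Equiv.swap i j` is `w` with the values in positions `i` and `j` exchanged. -/

/-! ### Reduced words, length and Bruhat covers in the symmetric group -/

/-- Indices of the simple transpositions of `S_n`. -/
abbrev Letter (n : ℕ) : Type := {i : ℕ // i + 1 < n}

/-- The smaller of the two points moved by `s_i`. -/
def Letter.lo {n : ℕ} (i : Letter n) : Fin n := ⟨i.1, Nat.lt_of_succ_lt i.2⟩

/-- The larger of the two points moved by `s_i`. -/
def Letter.hi {n : ℕ} (i : Letter n) : Fin n := ⟨i.1 + 1, i.2⟩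

/-- The simple transposition `s_i = (i, i + 1)`. -/
def simple {n : ℕ} (i : Letter n) : Equiv.Perm (Fin n) := Equiv.swap i.lo i.hi

/-- The product `s_{a_1} ⋯ s_{a_p}` in `S_n`. -/
def wordProd {n : ℕ} (a : List (Letter n)) : Equiv.Perm (Fin n) := (a.map simple).prod

/-- The length of `w`: the least number of factors in an expression of `w` as a product of simple
transpositions. -/
noncomputable def len {n : ℕ} (w : Equiv.Perm (Fin n)) : ℕ :=
  sInf {p : ℕ | ∃ a : List (Letter n), wordProd a = w ∧ a.length = p}

/-- The set `R(w)` of reduced words of `w`. -/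
def reducedWords {n : ℕ} (w : Equiv.Perm (Fin n)) : Set (List (Letter n)) :=
  {a | wordProd a = w ∧ a.length = len w}

/-- The cover relation `v ⋖ w` of the strong Bruhat order: `w = v t_{ij}` for some transposition
`t_{ij}`, and `ℓ(w) = ℓ(v) + 1`. -/
def BruhatCover {n : ℕ} (v w : Equiv.Perm (Fin n)) : Prop :=
  (∃ i j : Fin n, i ≠ j ∧ w = v * Equiv.swap i j) ∧ len w = len v + 1

/-! ### The 0-Hecke product with a simple transposition -/

open Classical in
/-- `w ∘ s_i` in the 0-Hecke monoid. -/
noncomputable def heckeRight {n : ℕ} (w : Equiv.Perm (Fin n)) (i : Letter n) :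
    Equiv.Perm (Fin n) :=
  if BruhatCover w (w * simple i) then w * simple i else w

open Classical in
/-- `s_i ∘ w` in the 0-Hecke monoid. -/
noncomputable def heckeLeft {n : ℕ} (i : Letter n) (w : Equiv.Perm (Fin n)) :
    Equiv.Perm (Fin n) :=
  if BruhatCover w (simple i * w) then simple i * w else w

/-! ### Blocks and `μ`-involutions -/

/-- The standardization of a word `f(1) ⋯ f(k)` with distinct letters: the permutation of
`{1, …, k}` in the same relative order (see `std_lt_std_iff`). -/
def std {k n : ℕ} (f : Fin k → Fin n) : Equiv.Perm (Fin k) := (Tuple.sort f)⁻¹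

theorem std_lt_std_iff {k n : ℕ} {f : Fin k → Fin n} (hf : Function.Injective f) (p q : Fin k) :
    std f p < std f q ↔ f p < f q := by
  have hm : StrictMono (f ∘ Tuple.sort f) :=
    (Tuple.monotone_sort f).strictMono_of_injective (hf.comp (Tuple.sort f).injective)
  have h := hm.lt_iff_lt (a := std f p) (b := std f q)
  simpa [std] using h.symm

/-- The `B`-th block of `(π, μ)`: the word of the values of `π` at the positions in the `B`-th
interval of the composition `μ`. -/
def block {n : ℕ} (μ : Composition n) (π : Equiv.Perm (Fin n)) (B : Fin μ.length) :
    Fin (μ.blocksFun B) → Fin n :=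
  fun p => π (μ.embedding B p)

theorem block_injective {n : ℕ} (μ : Composition n) (π : Equiv.Perm (Fin n))
    (B : Fin μ.length) : Function.Injective (block μ π B) :=
  π.injective.comp (μ.embedding B).injective

/-- The set `I_μ` of `μ`-involutions: the permutations all of whose blocks standardize to
involutions. -/
def muInvolutions {n : ℕ} (μ : Composition n) : Set (Equiv.Perm (Fin n)) :=
  {π | ∀ B : Fin μ.length, (std (block μ π B))⁻¹ = std (block μ π B)}

/-- The index of the block of `(π, μ)` that contains the value `a`. -/
def blockOf {n : ℕ} (μ : Composition n) (π : Equiv.Perm (Fin n)) (a : Fin n) : Fin μ.length :=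
  μ.index (π⁻¹ a)

/-- The relative value of `a` in the block of `(π, μ)` that contains it. -/
def relValue {n : ℕ} (μ : Composition n) (π : Equiv.Perm (Fin n)) (a : Fin n) :
    Fin (μ.blocksFun (blockOf μ π a)) :=
  std (block μ π (blockOf μ π a)) (μ.invEmbedding (π⁻¹ a))

theorem relValue_bound {n : ℕ} (μ : Composition n) (π : Equiv.Perm (Fin n)) (i : Letter n)
    (h : blockOf μ π i.lo = blockOf μ π i.hi) :
    (μ.embedding (blockOf μ π i.lo) (relValue μ π i.lo)).val + 1 < n := by
  have h2 : π⁻¹ i.hi ∈ Set.range (μ.embedding (blockOf μ π i.lo)) := by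
    rw [h]; exact μ.mem_range_embedding _
  obtain ⟨q, hq⟩ := h2
  have h1 : μ.embedding (blockOf μ π i.lo) (μ.invEmbedding (π⁻¹ i.lo)) = π⁻¹ i.lo :=
    μ.embedding_comp_inv _
  have h3 : relValue μ π i.lo < std (block μ π (blockOf μ π i.lo)) q := by
    refine (std_lt_std_iff (block_injective μ π _) _ _).2 ?_
    have e1 : block μ π (blockOf μ π i.lo) (μ.invEmbedding (π⁻¹ i.lo)) = i.lo := by
      unfold block; rw [h1]; simp
    have e2 : block μ π (blockOf μ π i.lo) q = i.hi := by
      unfold block; rw [hq]; simp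
    rw [e1, e2]
    exact Nat.lt_succ_self i.1
  have h4 := (μ.embedding (blockOf μ π i.lo)).strictMono h3
  exact lt_of_le_of_lt (Nat.succ_le_of_lt h4) (Fin.isLt _)

/-- When the values `i` and `i + 1` lie in the same block `B` of `(π, μ)`, the simple transposition
`s_{r_B(i)}` of the factor of `S_μ` that belongs to `B`, as a simple transposition of `S_n`: it
exchanges the positions of `B` whose ranks within `B` are `r_B(i)` and `r_B(i) + 1`. -/
def relLetter {n : ℕ} (μ : Composition n) (π : Equiv.Perm (Fin n)) (i : Letter n)
    (h : blockOf μ π i.lo = blockOf μ π i.hi) : Letter n :=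
  ⟨(μ.embedding (blockOf μ π i.lo) (relValue μ π i.lo)).val, relValue_bound μ π i h⟩

/-- The operation `π ∘_μ s_i`. -/
noncomputable def muAct {n : ℕ} (μ : Composition n) (π : Equiv.Perm (Fin n)) (i : Letter n) :
    Equiv.Perm (Fin n) :=
  if h : blockOf μ π i.lo = blockOf μ π i.hi then
    heckeRight (heckeLeft i π) (relLetter μ π i h)
  else heckeLeft i π

/-! ### `μ`-words and `μ`-atoms -/

/-- `a` is a `μ`-word for `π`, that is `π = e ∘_μ s_{a_1} ∘_μ ⋯ ∘_μ s_{a_p}`. -/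
def IsMuWord {n : ℕ} (μ : Composition n) (a : List (Letter n)) (π : Equiv.Perm (Fin n)) : Prop :=
  a.foldl (muAct μ) 1 = π

/-- `ℓ_μ(π)`: the least length of a `μ`-word for `π`. -/
noncomputable def muLen {n : ℕ} (μ : Composition n) (π : Equiv.Perm (Fin n)) : ℕ :=
  sInf {p : ℕ | ∃ a : List (Letter n), IsMuWord μ a π ∧ a.length = p}

/-- The set `R_μ(π)` of reduced `μ`-words for `π`. -/
def muReducedWords {n : ℕ} (μ : Composition n) (π : Equiv.Perm (Fin n)) :
    Set (List (Letter n)) :=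
  {a | IsMuWord μ a π ∧ a.length = muLen μ π}

/-- The set `A_μ(π)` of `μ`-atoms of `π`: the permutations that have a reduced word which is a
reduced `μ`-word for `π`. -/
def muAtoms {n : ℕ} (μ : Composition n) (π : Equiv.Perm (Fin n)) : Set (Equiv.Perm (Fin n)) :=
  {w | ∃ a, a ∈ reducedWords w ∧ a ∈ muReducedWords μ π}

/-! ### The transposition-like operators -/

/-- Some `μ`-atom `v` of `π` goes up by a Bruhat cover `v ⋖ v t_{ij}` to a `μ`-atom of `τ`. -/
def AtomCover {n : ℕ} (μ : Composition n) (i j : Fin n) (π τ : Equiv.Perm (Fin n)) : Prop :=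
  ∃ v ∈ muAtoms μ π, BruhatCover v (v * Equiv.swap i j) ∧ v * Equiv.swap i j ∈ muAtoms μ τ

/-- `τ` is a value that the definition of `t^μ_{ij}` assigns to `π`: either a `μ`-atom of `π` goes
up by a cover under `t_{ij}` to a `μ`-atom of `τ`, or there is no such cover, to a `μ`-atom of any
`μ`-involution, and `τ = π`. -/
def IsTransposeValue {n : ℕ} (μ : Composition n) (i j : Fin n) (π τ : muInvolutions μ) : Prop :=
  AtomCover μ i j π.1 τ.1 ∨ ((¬ ∃ σ : muInvolutions μ, AtomCover μ i j π.1 σ.1) ∧ τ = π)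

end MuInv

namespace MuInv

open Equiv

/-! Read a permutation `w` as the word `w⁻¹`, in which the letter `a` has position `w a`. A
`μ`-involution factors as `π⁻¹ = U y` (`BlockForm`), where `y` is an involution of the letters
preserving blocks and `U` is increasing on the letters of each block. Both factors are determined by
`π`, and `π` is determined by `y` together with the block of each letter.

Along a word that is reduced in both senses, a step with `i`, `i + 1` in different blocks replaces
`U` by `U s_i` and conjugates `y`; a step inside one block keeps `U` and either conjugates `y` by
`s_i` or multiplies it by `s_i`. By induction every atom `w` of `π` has its letters in the same
blocks as `U` and satisfies the pattern conditions `AtomLike` relative to `y`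
(`exists_blockForm_of_word`). Only this direction, that atoms satisfy the patterns, is needed.

It remains to show that if `w` fits `y`, `w ⋖ w t_ij` and `w t_ij` fits `z`, then `z` depends only
on `y`, `i`, `j` and the blocks (`AtomSwap.unique`). Off the cycles of `i` and `j` a counting
argument on the letters lying between two partners forces `z = y` (`AtomSwap.apply_eq`). On the
remaining set `{i, j, y i, y j}`, of at most four letters, the patterns for `y` and `z` are compared
case by case: different atoms may order these letters differently, but all lead to the same `z`. -/

/-! ### Length as number of inversions, and Bruhat covers. -/

theorem Letter.lo_lt_hi {n : ℕ} (i : Letter n) : i.lo < i.hi := Nat.lt_succ_self i.1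

theorem Letter.le_lo_of_lt_hi {n : ℕ} {i : Letter n} {a : Fin n} (h : a < i.hi) : a ≤ i.lo :=
  Nat.le_of_lt_succ h

theorem Letter.hi_le_of_lo_lt {n : ℕ} {i : Letter n} {a : Fin n} (h : i.lo < a) : i.hi ≤ a :=
  Nat.succ_le_of_lt h

theorem simple_apply_lo {n : ℕ} (i : Letter n) : simple i i.lo = i.hi := swap_apply_left _ _

theorem simple_apply_hi {n : ℕ} (i : Letter n) : simple i i.hi = i.lo := swap_apply_right _ _

theorem simple_apply_of_ne {n : ℕ} {i : Letter n} {a : Fin n} (h : a ≠ i.lo) (h' : a ≠ i.hi) :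
    simple i a = a := swap_apply_of_ne_of_ne h h'

theorem simple_simple {n : ℕ} (i : Letter n) (a : Fin n) : simple i (simple i a) = a :=
  by
  simp [simple]

theorem simple_mul_self {n : ℕ} (i : Letter n) : simple i * simple i = 1 := swap_mul_self _ _

theorem simple_inv {n : ℕ} (i : Letter n) : (simple i)⁻¹ = simple i := swap_inv _ _

/-- A simple transposition reverses the order of no pair other than the one it exchanges. -/
theorem simple_lt_simple {n : ℕ} {i : Letter n} {a b : Fin n} (h : a < b)
    (hne : ¬(a = i.lo ∧ b = i.hi)) : simple i a < simple i b := by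
  have h1 := @Letter.le_lo_of_lt_hi n i
  have h2 := @Letter.hi_le_of_lo_lt n i
  have h3 := i.lo_lt_hi
  by_cases a1 : a = i.lo
  · subst a1
    have : b ≠ i.hi := fun e => hne ⟨rfl, e⟩
    rw [simple_apply_lo, simple_apply_of_ne h.ne' this]
    exact lt_of_le_of_ne (h2 h) this.symm
  by_cases a2 : a = i.hi
  · subst a2
    rw [simple_apply_hi, simple_apply_of_ne (h3.trans h).ne' h.ne']
    exact h3.trans h
  rw [simple_apply_of_ne a1 a2]
  by_cases b1 : b = i.lo
  · subst b1; rw [simple_apply_lo]; exact h.trans h3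
  by_cases b2 : b = i.hi
  · subst b2; rw [simple_apply_hi]; exact lt_of_le_of_ne (h1 h) a1
  rwa [simple_apply_of_ne b1 b2]

/-- The set of inversions of a permutation. -/
def inversions {n : ℕ} (w : Perm (Fin n)) : Finset (Fin n × Fin n) :=
  Finset.univ.filter fun p => p.1 < p.2 ∧ w p.2 < w p.1

theorem mem_inversions {n : ℕ} {w : Perm (Fin n)} {p : Fin n × Fin n} :
    p ∈ inversions w ↔ p.1 < p.2 ∧ w p.2 < w p.1 := by simp [inversions]

/-- Applying `s_i` to both positions matches the inversions of `w` with those of `w s_i` other than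
`(i, i + 1)`, which is new. -/
theorem card_inversions_mul_simple {n : ℕ} {w : Perm (Fin n)} {i : Letter n}
    (h : w i.lo < w i.hi) : (inversions (w * simple i)).card = (inversions w).card + 1 := by
  have key : inversions (w * simple i) =
      insert (i.lo, i.hi) ((inversions w).map
        ((simple i).toEmbedding.prodMap (simple i).toEmbedding)) := by
    ext ⟨a, b⟩
    simp only [mem_inversions, Finset.mem_insert, Finset.mem_map, Perm.mul_apply, Prod.exists,
      Function.Embedding.prodMap, Function.Embedding.coeFn_mk, Prod.map, Prod.mk.injEq]
    constructor
    · rintro ⟨h1, h2⟩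
      by_cases e : a = i.lo ∧ b = i.hi
      · exact Or.inl e
      · exact Or.inr ⟨simple i a, simple i b, ⟨simple_lt_simple h1 e, h2⟩,
          simple_simple i a, simple_simple i b⟩
    · rintro (⟨rfl, rfl⟩ | ⟨c, d, ⟨h1, h2⟩, rfl, rfl⟩)
      · rw [simple_apply_lo, simple_apply_hi]; exact ⟨i.lo_lt_hi, h⟩
      · rw [simple_simple, simple_simple]
        refine ⟨simple_lt_simple h1 ?_, h2⟩
        rintro ⟨rfl, rfl⟩
        exact absurd h2 h.not_gt
  rw [key, Finset.card_insert_of_notMem, Finset.card_map]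
  simp only [Finset.mem_map, mem_inversions, Prod.exists, Function.Embedding.prodMap,
    Function.Embedding.coeFn_mk, Prod.map, Prod.mk.injEq, not_exists]
  rintro c d ⟨⟨h1, -⟩, h2, h3⟩
  have e1 : c = i.hi := by rw [← simple_simple i c, h2, simple_apply_lo]
  have e2 : d = i.lo := by rw [← simple_simple i d, h3, simple_apply_hi]
  subst e1 e2
  exact absurd h1 i.lo_lt_hi.not_gt

theorem card_inversions_mul_simple_of_gt {n : ℕ} {w : Perm (Fin n)} {i : Letter n}
    (h : w i.hi < w i.lo) : (inversions w).card = (inversions (w * simple i)).card + 1 := by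
  have := card_inversions_mul_simple (w := w * simple i) (i := i)
    (by simpa [simple_apply_lo, simple_apply_hi] using h)
  rwa [mul_assoc, simple_mul_self, mul_one] at this

theorem wordProd_append_singleton {n : ℕ} (a : List (Letter n)) (i : Letter n) :
    wordProd (a ++ [i]) = wordProd a * simple i := by
  simp [wordProd]

theorem card_inversions_mul_simple_le {n : ℕ} (w : Perm (Fin n)) (i : Letter n) :
    (inversions (w * simple i)).card ≤ (inversions w).card + 1 := by
  rcases lt_or_gt_of_ne (w.injective.ne i.lo_lt_hi.ne) with h | h
  · exact (card_inversions_mul_simple h).le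
  · have := card_inversions_mul_simple_of_gt h
    omega

theorem card_inversions_one {n : ℕ} : (inversions (1 : Perm (Fin n))).card = 0 := by
  rw [Finset.card_eq_zero, Finset.eq_empty_iff_forall_notMem]
  intro p hp
  rw [mem_inversions] at hp
  exact lt_asymm hp.1 hp.2

theorem card_inversions_wordProd_le {n : ℕ} (a : List (Letter n)) :
    (inversions (wordProd a)).card ≤ a.length := by
  induction a using List.reverseRecOn with
  | nil => exact card_inversions_one.le
  | append_singleton a i ih =>
    rw [wordProd_append_singleton, List.length_append, List.length_singleton]
    exact (card_inversions_mul_simple_le _ _).trans (Nat.add_le_add_right ih 1)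

theorem eq_id_of_strictMono {n : ℕ} {f : Fin n → Fin n} (hf : StrictMono f) : f = id :=
  (hf.range_inj strictMono_id).1 (by
    rw [(Finite.surjective_of_injective hf.injective).range_eq, Set.range_id])

theorem swap_eq_conj {α : Type*} [DecidableEq α] {i j k : α} (hik : i ≠ k) (hkj : k ≠ j)
    (hij : i ≠ j) : swap i j = swap i k * swap k j * swap i k := by
  ext x
  simp only [Perm.mul_apply, Equiv.swap_apply_def]
  split_ifs <;> simp_all

theorem exists_descent {n : ℕ} {w : Perm (Fin n)} (h : w ≠ 1) :
    ∃ i : Letter n, w i.hi < w i.lo := by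
  by_contra! H
  apply h
  have hs : StrictMono w := by
    rcases n with _ | n
    · exact fun a => a.elim0
    · refine Fin.strictMono_iff_lt_succ.2 fun k => ?_
      have := H ⟨k.1, by omega⟩
      refine lt_of_le_of_ne this (w.injective.ne ?_)
      exact k.castSucc_lt_succ.ne
  exact Equiv.ext (congrFun (eq_id_of_strictMono hs))

theorem exists_wordProd_eq {n : ℕ} (w : Perm (Fin n)) :
    ∃ a : List (Letter n), wordProd a = w ∧ a.length = (inversions w).card := by
  induction hk : (inversions w).card generalizing w with
  | zero =>
    refine ⟨[], ?_, rfl⟩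
    by_contra hne
    obtain ⟨i, hi⟩ := exists_descent (w := w) fun e => hne (by rw [e]; rfl)
    have := card_inversions_mul_simple_of_gt hi
    omega
  | succ k ih =>
    have hne : w ≠ 1 := by
      rintro rfl
      rw [card_inversions_one] at hk
      omega
    obtain ⟨i, hi⟩ := exists_descent hne
    have := card_inversions_mul_simple_of_gt hi
    obtain ⟨a, ha, hl⟩ := ih (w * simple i) (by omega)
    exact ⟨a ++ [i], by rw [wordProd_append_singleton, ha, mul_assoc, simple_mul_self, mul_one],
      by simp [hl]⟩

/-- Cancelling descents sorts `w` at one simple factor per inversion, and no factor can change the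
number of inversions by more than one. -/
theorem len_eq_card_inversions {n : ℕ} (w : Perm (Fin n)) : len w = (inversions w).card := by
  apply le_antisymm
  · exact Nat.sInf_le (exists_wordProd_eq w)
  · obtain ⟨a, ha, hl⟩ := exists_wordProd_eq w
    refine le_csInf ⟨_, a, ha, rfl⟩ ?_
    rintro p ⟨b, rfl, rfl⟩
    exact card_inversions_wordProd_le b

theorem len_wordProd_le {n : ℕ} (a : List (Letter n)) : len (wordProd a) ≤ a.length := by
  rw [len_eq_card_inversions]; exact card_inversions_wordProd_le a

theorem len_mul_simple {n : ℕ} {w : Perm (Fin n)} {i : Letter n} (h : w i.lo < w i.hi) :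
    len (w * simple i) = len w + 1 := by
  rw [len_eq_card_inversions, len_eq_card_inversions, card_inversions_mul_simple h]

theorem len_mul_simple_of_gt {n : ℕ} {w : Perm (Fin n)} {i : Letter n} (h : w i.hi < w i.lo) :
    len w = len (w * simple i) + 1 := by
  rw [len_eq_card_inversions, len_eq_card_inversions, card_inversions_mul_simple_of_gt h]

theorem bruhatCover_mul_simple_iff {n : ℕ} {w : Perm (Fin n)} {i : Letter n} :
    BruhatCover w (w * simple i) ↔ w i.lo < w i.hi := by
  constructor
  · rintro ⟨-, h⟩
    by_contra h'
    have := len_mul_simple_of_gt (lt_of_le_of_ne (not_lt.1 h') (w.injective.ne i.lo_lt_hi.ne'))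
    omega
  · exact fun h => ⟨⟨i.lo, i.hi, i.lo_lt_hi.ne, rfl⟩, len_mul_simple h⟩

theorem inversions_inv_card {n : ℕ} (w : Perm (Fin n)) :
    (inversions w⁻¹).card = (inversions w).card := by
  refine Finset.card_bij (fun p _ => (w⁻¹ p.2, w⁻¹ p.1)) ?_ ?_ ?_
  · rintro ⟨a, b⟩ h
    simp only [mem_inversions] at h ⊢
    simpa using h.symm
  · rintro ⟨a, b⟩ - ⟨c, d⟩ - h
    simpa [and_comm] using h
  · rintro ⟨a, b⟩ h
    simp only [mem_inversions] at h
    exact ⟨(w b, w a), by simpa [mem_inversions] using h.symm, by simp⟩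

theorem len_inv {n : ℕ} (w : Perm (Fin n)) : len w⁻¹ = len w := by
  rw [len_eq_card_inversions, len_eq_card_inversions, inversions_inv_card]

theorem bruhatCover_simple_mul_iff {n : ℕ} {w : Perm (Fin n)} {i : Letter n} :
    BruhatCover w (simple i * w) ↔ w⁻¹ i.lo < w⁻¹ i.hi := by
  rw [← bruhatCover_mul_simple_iff]
  have e : w⁻¹ * simple i = (simple i * w)⁻¹ := by rw [mul_inv_rev, simple_inv]
  unfold BruhatCover
  rw [e, len_inv, len_inv]
  refine and_congr_left fun _ => ⟨fun _ => ⟨i.lo, i.hi, i.lo_lt_hi.ne, ?_⟩,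
    fun _ => ⟨w⁻¹ i.lo, w⁻¹ i.hi, w⁻¹.injective.ne i.lo_lt_hi.ne, ?_⟩⟩
  · rw [← e]; rfl
  -- `BruhatCover` wants the transposition on the right: `s_i w = w t` with `t` exchanging the
  -- positions `w⁻¹ i` and `w⁻¹ (i + 1)`.
  · rw [simple, Equiv.swap_apply_apply]; simp [mul_assoc]

/-- With `k = i + 1`, write `t_ij = s_i t_kj s_i`. The middle factor raises the length by induction
on the distance `d + 1`, and the two outer factors never both lower it. -/
theorem len_lt_len_mul_swap {n : ℕ} (d : ℕ) : ∀ (w : Perm (Fin n)) (i j : Fin n),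
    i.1 + d + 1 = j.1 → w i < w j → len w < len (w * swap i j) := by
  induction d with
  | zero =>
    intro w i j hij h
    let l : Letter n := ⟨i.1, by omega⟩
    have e : l.hi = j := Fin.ext (by simp [l, Letter.hi, ← hij])
    have e' : l.lo = i := rfl
    have := len_mul_simple (w := w) (i := l) (by rw [e, e']; exact h)
    rw [simple, e, e'] at this
    omega
  | succ d ih =>
    intro w i j hij h
    let l : Letter n := ⟨i.1, by omega⟩
    have el : l.lo = i := rfl
    obtain ⟨k, ek⟩ : ∃ k, k = l.hi := ⟨_, rfl⟩
    have hk : k.1 = i.1 + 1 := by rw [ek]; rfl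
    have hik : i ≠ k := by intro e; rw [e] at hk; omega
    have hkj : k ≠ j := by intro e; rw [e] at hk; omega
    have hij' : i ≠ j := by intro e; rw [e] at hij; omega
    have hs : simple l = swap i k := by rw [simple, el, ek]
    have conj := swap_eq_conj hik hkj hij'
    set w1 := w * swap i k with hw1
    set w2 := w1 * swap k j with hw2
    have e : w * swap i j = w2 * swap i k := by rw [conj, hw2, hw1]; simp only [mul_assoc]
    have a1 : w1 k = w i := by simp [hw1]
    have a2 : w1 j = w j := by simp [hw1, swap_apply_of_ne_of_ne hij'.symm hkj.symm]
    have a3 : w1 i = w k := by simp [hw1]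
    have b1 : w2 i = w k := by simp [hw2, swap_apply_of_ne_of_ne hik hij', a3]
    have b2 : w2 k = w j := by simp [hw2, a2]
    have up : len w1 < len w2 := ih w1 k j (by omega) (by rw [a1, a2]; exact h)
    rw [e]
    have up1 : w i < w k → len w1 = len w + 1 := fun h' => by
      rw [hw1, ← hs]; exact len_mul_simple (by rw [el, ← ek]; exact h')
    have dn1 : w k < w i → len w = len w1 + 1 := fun h' => by
      rw [hw1, ← hs]; exact len_mul_simple_of_gt (by rw [el, ← ek]; exact h')
    have up2 : w2 i < w2 k → len (w2 * swap i k) = len w2 + 1 := fun h' => by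
      rw [← hs]; exact len_mul_simple (by rw [el, ← ek]; exact h')
    have dn2 : w2 k < w2 i → len w2 = len (w2 * swap i k) + 1 := fun h' => by
      rw [← hs]; exact len_mul_simple_of_gt (by rw [el, ← ek]; exact h')
    rw [b1, b2] at up2 dn2
    rcases lt_or_gt_of_ne (w.injective.ne hik) with h1 | h1
    · have := up1 h1
      rcases lt_or_gt_of_ne (w.injective.ne hkj) with h2 | h2
      · have := up2 h2; omega
      · have := dn2 h2; omega
    · have := dn1 h1
      have := up2 (h1.trans h); omega

theorem len_lt_len_mul_swap_of_lt {n : ℕ} {w : Perm (Fin n)} {i j : Fin n} (hij : i < j)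
    (h : w i < w j) : len w < len (w * swap i j) :=
  len_lt_len_mul_swap (j.1 - i.1 - 1) w i j (by have : i.1 < j.1 := hij; omega) h

theorem lt_of_bruhatCover_swap {n : ℕ} {w : Perm (Fin n)} {i j : Fin n} (hij : i < j)
    (h : BruhatCover w (w * swap i j)) : w i < w j := by
  by_contra h'
  have h2 : w j < w i := lt_of_le_of_ne (not_lt.1 h') (w.injective.ne hij.ne')
  have := len_lt_len_mul_swap_of_lt (w := w * swap i j) hij (by simpa using h2)
  rw [mul_assoc, swap_mul_self, mul_one] at this
  have := h.2
  omega

/-- An intermediate value at `k` would make each of the three factors of `t_ij = t_ik t_kj t_ik`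
raise the length. -/
theorem not_between_of_bruhatCover_swap {n : ℕ} {w : Perm (Fin n)} {i j k : Fin n}
    (h : BruhatCover w (w * swap i j)) (hik : i < k) (hkj : k < j) :
    ¬(w i < w k ∧ w k < w j) := by
  rintro ⟨h1, h2⟩
  have hij := hik.trans hkj
  set w1 := w * swap i k with hw1
  set w2 := w1 * swap k j with hw2
  have e : w * swap i j = w2 * swap i k := by
    have conj := swap_eq_conj hik.ne hkj.ne hij.ne
    rw [conj, hw2, hw1]; simp only [mul_assoc]
  have a1 : w1 k = w i := by simp [hw1]
  have a2 : w1 j = w j := by simp [hw1, swap_apply_of_ne_of_ne hij.ne' hkj.ne']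
  have a3 : w1 i = w k := by simp [hw1]
  have b1 : w2 i = w k := by simp [hw2, swap_apply_of_ne_of_ne hik.ne hij.ne, a3]
  have b2 : w2 k = w j := by simp [hw2, a2]
  have l1 : len w < len w1 := len_lt_len_mul_swap_of_lt hik h1
  have l2 : len w1 < len w2 := len_lt_len_mul_swap_of_lt hkj (by rw [a1, a2]; exact h1.trans h2)
  have l3 := len_lt_len_mul_swap_of_lt (w := w2) hik (by rw [b1, b2]; exact h2)
  have := h.2
  rw [e] at this
  omega

/-! ### Pattern conditions and their stability under one letter of a word. -/

/-- The pattern conditions that characterize the atoms of an involution `y`: in the word `w⁻¹`,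
where the letter `a` has position `w a`, the larger letter of every two-cycle precedes the smaller
one with no letter of intermediate value in between, and any two cycles that are comparable occur
in increasing order.  Positions are grouped into blocks by `g`; the involution preserves the
blocks, and only cycles in the same block are compared. -/
structure AtomLike {n : ℕ} {ι : Type*} (g : Fin n → ι) (w y : Perm (Fin n)) : Prop where
  invol : ∀ a, y (y a) = a
  blk : ∀ a, g (w (y a)) = g (w a)
  desc : ∀ a, a < y a → w (y a) < w a
  between : ∀ a t, a < t → t < y a → ¬(w (y a) < w t ∧ w t < w a)
  order : ∀ a c, g (w a) = g (w c) → a ≤ y a → c ≤ y c → a < c → y a < y c → w a < w (y c)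

theorem AtomLike.one {n : ℕ} {ι : Type*} (g : Fin n → ι) : AtomLike g 1 1 where
  invol _ := rfl
  blk _ := rfl
  desc _ h := absurd h (lt_irrefl _)
  between _ _ h h' := absurd (h.trans h') (lt_irrefl _)
  order _ _ _ _ _ h _ := h

/-- The conditions only compare letters of one block, so a relabelling that is increasing on each
block preserves them. This covers a step with `i`, `i + 1` in different blocks. -/
theorem AtomLike.relabel {n : ℕ} {ι : Type*} [PartialOrder ι] {g : Fin n → ι} (hg : Monotone g)
    {w y s : Perm (Fin n)} (hP : AtomLike g w y) (hs : ∀ a, s (s a) = a)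
    (hmono : ∀ a b, g (w a) = g (w b) → a < b → s a < s b) :
    AtomLike g (w * s) (s * y * s) := by
  have hmono' : ∀ a b, g (w a) = g (w b) → s a < s b → a < b := by
    intro a b hab h
    by_contra h'
    rcases eq_or_lt_of_le (not_lt.1 h') with rfl | h'
    · exact lt_irrefl _ h
    · exact lt_asymm h (hmono _ _ hab.symm h')
  have hle : ∀ a, s a ≤ s (y a) → a ≤ y a := by
    intro a h
    rcases eq_or_lt_of_le h with h | h
    · exact (s.injective h).le
    · exact (hmono' _ _ (hP.blk a).symm h).le
  have key : ∀ P : Fin n → Prop, (∀ c, P (s c)) → ∀ a, P a := fun P h a => by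
    have := h (s a); rwa [hs] at this
  refine ⟨?_, ?_, ?_, ?_, ?_⟩ <;> simp only [Perm.mul_apply]
  · intro a; rw [hs, hP.invol, hs]
  · intro a; rw [hs, hP.blk]
  · refine key _ fun c => ?_
    simp only [hs]
    exact fun h => hP.desc _ (hmono' _ _ (hP.blk c).symm h)
  · refine key _ fun c => key _ fun t => ?_
    simp only [hs]
    intro h1 h2 h3
    -- The block of `t` is not given: it follows from its position, `g` being monotone.
    have e : g (w c) = g (w t) := le_antisymm (by rw [← hP.blk c]; exact hg h3.1.le) (hg h3.2.le)
    refine hP.between c t (hmono' _ _ e h1) (hmono' _ _ ?_ h2) h3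
    rw [← e, hP.blk]
  · refine key _ fun c => key _ fun d => ?_
    simp only [hs]
    intro e h1 h2 h3 h4
    exact hP.order _ _ e (hle _ h1) (hle _ h2) (hmono' _ _ e h3)
      (hmono' _ _ (by rw [hP.blk, hP.blk, e]) h4)

theorem lt_or_of_simple_lt_simple {n : ℕ} {i : Letter n} {c d : Fin n}
    (h : simple i c < simple i d) : c < d ∨ (c = i.hi ∧ d = i.lo) := by
  by_cases e : simple i c = i.lo ∧ simple i d = i.hi
  · right
    rw [← simple_simple i c, ← simple_simple i d, e.1, e.2, simple_apply_lo, simple_apply_hi]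
    exact ⟨rfl, rfl⟩
  · left
    simpa [simple_simple] using simple_lt_simple h e

/-- `s_i` reverses only the pair `i`, `i + 1`, so only conditions involving this pair need an
argument. The cycles of `i` and `i + 1` are comparable because `y i < y (i + 1)`, and `order` then
separates them in the word. -/
theorem AtomLike.conj {n : ℕ} {ι : Type*} {g : Fin n → ι}
    {w y : Perm (Fin n)} {i : Letter n} (hP : AtomLike g w y) (hblk : g (w i.lo) = g (w i.hi))
    (hy : y i.lo < y i.hi) (hne : ¬(y i.lo = i.lo ∧ y i.hi = i.hi)) :
    AtomLike g (w * simple i) (simple i * y * simple i) := by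
  have hs := simple_simple i
  have hlh := i.lo_lt_hi
  have h1 := @Letter.le_lo_of_lt_hi n i
  have h2 := @Letter.hi_le_of_lo_lt n i
  have hsw : y i.hi ≠ i.lo := by
    intro e
    have := hP.invol i.hi
    rw [e] at this hy
    rw [this] at hy
    exact lt_asymm hlh hy
  have key : ∀ P : Fin n → Prop, (∀ c, P (simple i c)) → ∀ a, P a := fun P h a => by
    have := h (simple i a); rwa [hs] at this
  have hle : ∀ a, simple i a ≤ simple i (y a) → a ≤ y a := by
    intro a h
    rcases eq_or_lt_of_le h with h | h
    · exact ((simple i).injective h).le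
    · rcases lt_or_of_simple_lt_simple h with h | ⟨rfl, h⟩
      · exact h.le
      · exact absurd h hsw
  refine ⟨?_, ?_, ?_, ?_, ?_⟩ <;> simp only [Perm.mul_apply]
  · intro a; rw [hs, hP.invol, hs]
  · intro a; rw [hs, hP.blk]
  · refine key _ fun c => ?_
    simp only [hs]
    intro h
    rcases lt_or_of_simple_lt_simple h with h | ⟨rfl, h⟩
    · exact hP.desc _ h
    · exact absurd h hsw
  · refine key _ fun c => key _ fun t => ?_
    simp only [hs]
    rintro h3 h4 ⟨h5, h6⟩
    rcases lt_or_of_simple_lt_simple h3 with h3 | ⟨rfl, rfl⟩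
    · rcases lt_or_of_simple_lt_simple h4 with h4 | ⟨rfl, h4'⟩
      · exact hP.between _ _ h3 h4 ⟨h5, h6⟩
      -- Here `c` is the partner of `i` and `t = i + 1`. By `order` the cycle of `i` wholly precedes
      -- that of `i + 1`, so `i + 1` cannot come before `c`.
      · have ec : c = y i.lo := by rw [← h4', hP.invol]
        subst ec
        have h7 := h1 h3
        rw [hP.invol] at h5
        rcases lt_or_ge i.lo (y i.hi) with h8 | h8
        · have h9 := h2 h8
          have h10 := hP.order (y i.lo) i.hi (by rw [hP.blk, hblk]) (by rwa [hP.invol]) h9 h3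
            (by rwa [hP.invol])
          rcases eq_or_lt_of_le h9 with h9 | h9
          · rw [← h9] at h10; exact lt_asymm h6 h10
          · exact lt_asymm h6 (h10.trans (hP.desc _ h9))
        · have h10 := hP.order (y i.lo) (y i.hi) (by rw [hP.blk, hP.blk, hblk])
            (by rwa [hP.invol]) (by rw [hP.invol]; exact h8.trans hlh.le) hy
            (by rwa [hP.invol, hP.invol])
          rw [hP.invol] at h10
          exact lt_asymm h6 h10
    · rcases lt_or_of_simple_lt_simple h4 with h4 | ⟨h4, -⟩
      · rcases le_or_gt i.lo (y i.lo) with h8 | h8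
        · exact lt_asymm h5 (hP.order i.lo i.hi hblk h8 (h2 h4) hlh hy)
        · have h10 := hP.order (y i.lo) i.hi (by rw [hP.blk, hblk])
            (by rw [hP.invol]; exact h8.le) (h2 h4) (h8.trans hlh) (by rwa [hP.invol])
          have h11 := hP.desc (y i.lo) (by rwa [hP.invol])
          rw [hP.invol] at h11
          exact lt_asymm h5 (h11.trans h10)
      · exact hlh.ne h4
  · refine key _ fun c => key _ fun d => ?_
    simp only [hs]
    intro e h3 h4 h5 h6
    rcases lt_or_of_simple_lt_simple h5 with h5 | ⟨rfl, rfl⟩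
    · rcases lt_or_of_simple_lt_simple h6 with h6 | ⟨h6, h7⟩
      · exact hP.order _ _ e (hle _ h3) (hle _ h4) h5 h6
      · rw [← h6, ← h7, hP.invol, hP.invol] at hy
        exact absurd hy h5.not_gt
    -- The only place where two fixed points must be excluded.
    · exact absurd h6 (simple_lt_simple hy hne).not_gt

/-- The new cycle consists of consecutive values, so nothing is intermediate; the ascent of `w` puts
its larger letter first; its comparisons with other cycles are inherited from the fixed points `i`
and `i + 1`. -/
theorem AtomLike.insert_cycle {n : ℕ} {ι : Type*} {g : Fin n → ι}
    {w y : Perm (Fin n)} {i : Letter n} (hP : AtomLike g w y) (hblk : g (w i.lo) = g (w i.hi))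
    (hw : w i.lo < w i.hi) (hlo : y i.lo = i.lo) (hhi : y i.hi = i.hi) :
    AtomLike g (w * simple i) (simple i * y) := by
  have hlh := i.lo_lt_hi
  have h1 := @Letter.le_lo_of_lt_hi n i
  have h2 := @Letter.hi_le_of_lo_lt n i
  have slo := simple_apply_lo i
  have shi := simple_apply_hi i
  have ylo : ∀ a, a ≠ i.lo → y a ≠ i.lo := fun a h e => h (y.injective (e.trans hlo.symm))
  have yhi : ∀ a, a ≠ i.hi → y a ≠ i.hi := fun a h e => h (y.injective (e.trans hhi.symm))
  have sel : ∀ a, a ≠ i.lo → a ≠ i.hi → simple i a = a := fun a => simple_apply_of_ne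
  have syl : ∀ a, a ≠ i.lo → a ≠ i.hi → simple i (y a) = y a :=
    fun a h h' => sel _ (ylo a h) (yhi a h')
  have hs := simple_simple i
  refine ⟨?_, ?_, ?_, ?_, ?_⟩ <;> simp only [Perm.mul_apply]
  · intro a
    by_cases a1 : a = i.lo
    · subst a1; rw [hlo, slo, hhi, shi]
    by_cases a2 : a = i.hi
    · subst a2; rw [hhi, shi, hlo, slo]
    rw [syl a a1 a2, hP.invol, sel a a1 a2]
  · intro a
    rw [hs, hP.blk]
    by_cases a1 : a = i.lo
    · subst a1; rw [slo, hblk]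
    by_cases a2 : a = i.hi
    · subst a2; rw [shi, hblk]
    rw [sel a a1 a2]
  · intro a
    rw [hs]
    by_cases a1 : a = i.lo
    · subst a1; rw [slo, hlo]; exact fun _ => hw
    by_cases a2 : a = i.hi
    · subst a2; rw [hhi, shi]; exact fun h => absurd h hlh.not_gt
    rw [sel a a1 a2, syl a a1 a2]
    exact hP.desc a
  · intro a t
    rw [hs]
    by_cases a1 : a = i.lo
    · subst a1; rw [hlo, slo]; exact fun h h' => absurd (h2 h) h'.not_ge
    by_cases a2 : a = i.hi
    · subst a2; rw [hhi, shi]; exact fun h h' => absurd (h.trans h') hlh.not_gt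
    rw [sel a a1 a2, syl a a1 a2]
    intro h3 h4
    by_cases t1 : t = i.lo
    · subst t1; rw [slo]
      exact hP.between a _ (h3.trans hlh) (lt_of_le_of_ne (h2 h4) (yhi a a2).symm)
    by_cases t2 : t = i.hi
    · subst t2; rw [shi]
      exact hP.between a _ (lt_of_le_of_ne (h1 h3) a1) (hlh.trans h4)
    rw [sel t t1 t2]
    exact hP.between a t h3 h4
  · intro a c
    rw [hs]
    by_cases a1 : a = i.lo
    · subst a1
      rw [hlo, slo]
      intro e _ h4 h5 h6
      have c1 : c ≠ i.lo := h5.ne'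
      have c2 : c ≠ i.hi := by rintro rfl; rw [hhi, shi] at h6; exact lt_asymm hlh h6
      rw [syl c c1 c2] at h4 h6
      rw [sel c c1 c2] at e
      exact hP.order _ _ e hhi.ge h4 (lt_of_le_of_ne (h2 h5) c2.symm) (by rwa [hhi])
    by_cases a2 : a = i.hi
    · subst a2; rw [hhi, shi]; exact fun _ h => absurd h hlh.not_ge
    rw [sel a a1 a2, syl a a1 a2]
    by_cases c1 : c = i.lo
    · subst c1
      rw [hlo, slo]
      intro e h3 h4 h5 h6
      have := hP.order a i.lo (by rw [e, hblk]) h3 hlo.ge h5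
        (by rw [hlo]; exact lt_of_le_of_ne (h1 h6) (ylo a a1))
      rwa [hlo] at this
    by_cases c2 : c = i.hi
    · subst c2; rw [hhi, shi]; exact fun _ _ h => absurd h hlh.not_ge
    rw [sel c c1 c2, syl c c1 c2]
    exact hP.order a c

/-! ### The factorization `π⁻¹ = U y` and the action of one letter on it. -/

theorem index_monotone {n : ℕ} (μ : Composition n) : Monotone μ.index := by
  intro a b h
  by_contra h'
  have h1 : (b : ℕ) < μ.sizeUpTo (μ.index b : ℕ).succ := μ.lt_sizeUpTo_index_succ b
  have h2 := μ.sizeUpTo_index_le a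
  have h3 : (μ.index b : ℕ).succ ≤ μ.index a := not_le.1 h'
  have h4 : μ.sizeUpTo (μ.index b : ℕ).succ ≤ μ.sizeUpTo (μ.index a) := μ.monotone_sizeUpTo h3
  have h5 : a.1 ≤ b.1 := h
  omega

/-- A factorization `π⁻¹ = U y` where `y` is an involution of the values preserving each block and
`U⁻¹` is increasing on each block. -/
structure BlockForm {n : ℕ} (μ : Composition n) (π U y : Perm (Fin n)) : Prop where
  inv_eq : π⁻¹ = U * y
  invol : ∀ a, y (y a) = a
  blk : ∀ a, μ.index (U (y a)) = μ.index (U a)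
  mono : ∀ a c, μ.index (U a) = μ.index (U c) → a < c → U a < U c

/-- A bijection that is increasing on blocks is determined by the blocks. -/
theorem eq_of_index_eq {n : ℕ} {μ : Composition n} {U : Perm (Fin n)} {V : Fin n → Fin n}
    (hidx : ∀ a, μ.index (V a) = μ.index (U a))
    (hU : ∀ a c, μ.index (U a) = μ.index (U c) → a < c → U a < U c)
    (hV : ∀ a c, μ.index (U a) = μ.index (U c) → a < c → V a < V c) (a : Fin n) : V a = U a := by
  have hm : StrictMono (V ∘ U.symm) := by
    intro p q hpq
    obtain ⟨a, rfl⟩ := U.surjective p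
    obtain ⟨c, rfl⟩ := U.surjective q
    simp only [Function.comp, Equiv.symm_apply_apply]
    by_cases e : μ.index (U a) = μ.index (U c)
    · refine hV a c e ?_
      by_contra h
      rcases eq_or_lt_of_le (not_lt.1 h) with rfl | h
      · exact lt_irrefl _ hpq
      · exact lt_asymm hpq (hU _ _ e.symm h)
    · by_contra h
      have h1 := index_monotone μ (not_lt.1 h)
      rw [hidx, hidx] at h1
      exact e (le_antisymm (index_monotone μ hpq.le) h1)
  have := congrFun (eq_id_of_strictMono hm) (U a)
  simpa using this

/-- `U` is the only bijection increasing on blocks that puts letters in the same blocks as `π⁻¹`;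
then `y = U⁻¹ π⁻¹`. -/
theorem BlockForm.unique {n : ℕ} {μ : Composition n} {π U U' y y' : Perm (Fin n)}
    (h : BlockForm μ π U y) (h' : BlockForm μ π U' y') : y = y' := by
  have hb : ∀ {U y : Perm (Fin n)}, BlockForm μ π U y → ∀ a, μ.index (U a) = μ.index (π⁻¹ a) :=
    fun h a => by rw [h.inv_eq, Perm.mul_apply, h.blk]
  have e : U' = U := Equiv.ext (eq_of_index_eq (fun a => by rw [hb h, hb h']) h.mono
    fun a c hac => h'.mono a c (by rw [hb h', hb h', ← hb h, ← hb h, hac]))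
  subst e
  exact mul_left_cancel (h.inv_eq.symm.trans h'.inv_eq)

theorem BlockForm.ext {n : ℕ} {μ : Composition n} {π σ U U' y : Perm (Fin n)}
    (h : BlockForm μ π U y) (h' : BlockForm μ σ U' y)
    (hidx : ∀ a, μ.index (U' a) = μ.index (U a)) : π = σ := by
  have e : U' = U := Equiv.ext (eq_of_index_eq hidx h.mono
    fun a c hac => h'.mono a c (by rw [hidx, hidx, hac]))
  subst e
  exact inv_injective (h.inv_eq.trans h'.inv_eq.symm)

theorem BlockForm.blockOf_eq {n : ℕ} {μ : Composition n} {π U y : Perm (Fin n)}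
    (h : BlockForm μ π U y) (a : Fin n) : blockOf μ π a = μ.index (U a) := by
  rw [blockOf, h.inv_eq, Perm.mul_apply, h.blk]

theorem embedding_relValue {n : ℕ} (μ : Composition n) (π : Perm (Fin n)) (a : Fin n)
    {B : Fin μ.length} {q : Fin (μ.blocksFun B)} (h : π⁻¹ a = μ.embedding B q) :
    μ.embedding (blockOf μ π a) (relValue μ π a) = μ.embedding B (std (block μ π B) q) := by
  obtain rfl : B = blockOf μ π a := by rw [blockOf, h, μ.index_embedding]
  have : μ.invEmbedding (π⁻¹ a) = q := by
    apply (μ.embedding (blockOf μ π a)).injective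
    exact (μ.embedding_comp_inv _).trans h
  rw [relValue, this]

/-- Sending a letter to the position given by its rank in its block respects blocks and is
increasing on them, hence is `U`. So the letter `r` of `relLetter` satisfies `s_r = U s_i U⁻¹`. -/
theorem BlockForm.embedding_relValue_eq {n : ℕ} {μ : Composition n} {π U y : Perm (Fin n)}
    (h : BlockForm μ π U y) (a : Fin n) :
    μ.embedding (blockOf μ π a) (relValue μ π a) = U a := by
  refine eq_of_index_eq (μ := μ) (V := fun a => μ.embedding (blockOf μ π a) (relValue μ π a))
    (fun a => ?_) h.mono (fun a c hac hlt => ?_) a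
  · rw [μ.index_embedding, h.blockOf_eq]
  · rw [← h.blockOf_eq, ← h.blockOf_eq] at hac
    obtain ⟨q, hq⟩ := μ.mem_range_embedding (π⁻¹ c)
    obtain ⟨p, hp⟩ := μ.mem_range_embedding (π⁻¹ a)
    change μ.embedding (blockOf μ π c) q = _ at hq
    change μ.embedding (blockOf μ π a) p = _ at hp
    have hq' : ∃ q, μ.embedding (blockOf μ π a) q = π⁻¹ c := by rw [hac]; exact ⟨q, hq⟩
    obtain ⟨r, hr⟩ := hq'
    rw [embedding_relValue μ π a hp.symm, embedding_relValue μ π c hr.symm]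
    refine (μ.embedding _).strictMono ((std_lt_std_iff (block_injective μ π _) _ _).2 ?_)
    simpa [block, hp, hr] using hlt

theorem BlockForm.one {n : ℕ} (μ : Composition n) : BlockForm μ 1 1 1 where
  inv_eq := rfl
  invol _ := rfl
  blk _ := rfl
  mono _ _ _ h := h

/-- `π⁻¹ s_i = (U s_i)(s_i y s_i)`, and `U s_i` stays increasing on blocks because the one pair
reversed by `s_i` is split between two blocks. -/
theorem BlockForm.muAct_of_ne {n : ℕ} {μ : Composition n} {π U y : Perm (Fin n)}
    (h : BlockForm μ π U y) {i : Letter n} (hi : μ.index (U i.lo) ≠ μ.index (U i.hi))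
    (hne : muAct μ π i ≠ π) :
    BlockForm μ (muAct μ π i) (U * simple i) (simple i * y * simple i) := by
  have hact : muAct μ π i = simple i * π := by
    have e : muAct μ π i = heckeLeft i π := by
      rw [muAct, dif_neg (by rwa [h.blockOf_eq, h.blockOf_eq])]
    rw [e] at hne ⊢
    unfold heckeLeft at hne ⊢
    split_ifs at hne ⊢ with h'
    · rfl
    · exact absurd rfl hne
  rw [hact]
  refine ⟨?_, fun a => ?_, fun a => ?_, fun a c hac hlt => ?_⟩
  · rw [mul_inv_rev, simple_inv, h.inv_eq]
    simp only [mul_assoc]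
    rw [← mul_assoc (simple i) (simple i), simple_mul_self, one_mul]
  · simp only [Perm.mul_apply]; rw [simple_simple, h.invol, simple_simple]
  · simp only [Perm.mul_apply]; rw [simple_simple, h.blk]
  · refine h.mono _ _ hac (simple_lt_simple hlt ?_)
    rintro ⟨rfl, rfl⟩
    simp only [Perm.mul_apply, simple_apply_lo, simple_apply_hi] at hac
    exact hi hac.symm

theorem BlockForm.of_same_left {n : ℕ} {μ : Composition n} {π σ U y z : Perm (Fin n)}
    (h : BlockForm μ π U y) (hinv : σ⁻¹ = U * z) (hz : ∀ a, z (z a) = a)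
    (hblk : ∀ a, μ.index (U (z a)) = μ.index (U a)) : BlockForm μ σ U z :=
  ⟨hinv, hz, hblk, h.mono⟩

/-- A position strictly between would lie in the same block, so its letter would lie strictly
between `i` and `i + 1`. -/
theorem BlockForm.hi_eq {n : ℕ} {μ : Composition n} {π U y : Perm (Fin n)}
    (h : BlockForm μ π U y) {i : Letter n} (hi : μ.index (U i.lo) = μ.index (U i.hi)) :
    (U i.hi).1 = (U i.lo).1 + 1 := by
  have hlt : U i.lo < U i.hi := h.mono _ _ hi i.lo_lt_hi
  by_contra hne
  have h0 : (U i.lo).1 < (U i.hi).1 := hlt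
  obtain ⟨x, hx⟩ := U.surjective ⟨(U i.lo).1 + 1, by omega⟩
  have h1 : U i.lo < U x := by rw [hx]; exact Nat.lt_succ_self _
  have h2 : U x < U i.hi := by rw [hx]; exact lt_of_le_of_ne (Nat.succ_le_of_lt h0) (fun e => hne (congrArg Fin.val e).symm)
  have e : μ.index (U x) = μ.index (U i.lo) :=
    le_antisymm ((index_monotone μ h2.le).trans hi.ge) (index_monotone μ h1.le)
  rcases lt_trichotomy x i.lo with h3 | rfl | h3
  · exact lt_asymm h1 (h.mono _ _ e h3)
  · exact lt_irrefl _ h1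
  · rcases eq_or_lt_of_le (Letter.hi_le_of_lo_lt h3) with rfl | h4
    · exact lt_irrefl _ h2
    · exact lt_asymm h2 (h.mono _ _ (by rw [e, hi]) h4)

/-- Since `s_r = U s_i U⁻¹`, multiplying `π` on both sides conjugates `y`. If `y` fixes `i` and `i +
1`, then `s_i π = π s_r`, so the right factor is a descent and is absorbed. If `y i > y (i + 1)`,
both factors are absorbed. -/
theorem BlockForm.muAct_of_eq {n : ℕ} {μ : Composition n} {π U y : Perm (Fin n)}
    (h : BlockForm μ π U y) {i : Letter n} (hi : μ.index (U i.lo) = μ.index (U i.hi))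
    (hne : muAct μ π i ≠ π) : y i.lo < y i.hi ∧
      ((y i.lo = i.lo ∧ y i.hi = i.hi ∧ BlockForm μ (muAct μ π i) U (simple i * y)) ∨
      (¬(y i.lo = i.lo ∧ y i.hi = i.hi) ∧
        BlockForm μ (muAct μ π i) U (simple i * y * simple i))) := by
  have hb : blockOf μ π i.lo = blockOf μ π i.hi := by rwa [h.blockOf_eq, h.blockOf_eq]
  have hact : muAct μ π i = heckeRight (heckeLeft i π) (relLetter μ π i hb) := by
    rw [muAct, dif_pos hb]
  set r := relLetter μ π i hb with hr
  have rlo : r.lo = U i.lo := h.embedding_relValue_eq i.lo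
  have rhi : r.hi = U i.hi := Fin.ext (by
    rw [h.hi_eq hi, ← rlo]; rfl)
  have hyy : y * y = 1 := Equiv.ext h.invol
  have hyinv : y⁻¹ = y := inv_eq_of_mul_eq_one_left hyy
  have hpi : π = y * U⁻¹ := by
    rw [← inv_inv π, h.inv_eq, mul_inv_rev, hyinv]
  have plo : π r.lo = y i.lo := by rw [rlo, hpi]; simp
  have phi : π r.hi = y i.hi := by rw [rhi, hpi]; simp
  have pinv : ∀ a, π⁻¹ a = U (y a) := fun a => by rw [h.inv_eq]; rfl
  have hylo : μ.index (U (y i.lo)) = μ.index (U (y i.hi)) := by rw [h.blk, h.blk, hi]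
  have hsblk : ∀ a, μ.index (U (simple i a)) = μ.index (U a) := by
    intro a
    by_cases a1 : a = i.lo
    · subst a1; rw [simple_apply_lo, hi]
    by_cases a2 : a = i.hi
    · subst a2; rw [simple_apply_hi, hi]
    rw [simple_apply_of_ne a1 a2]
  have hlt : y i.lo < y i.hi := by
    by_contra hlt
    have hgt : y i.hi < y i.lo := lt_of_le_of_ne (not_lt.1 hlt) (y.injective.ne i.lo_lt_hi.ne')
    apply hne
    have e1 : heckeLeft i π = π := by
      rw [heckeLeft, if_neg]
      rw [bruhatCover_simple_mul_iff, pinv, pinv]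
      exact (h.mono _ _ hylo.symm hgt).not_gt
    rw [hact, e1, heckeRight, if_neg]
    rw [bruhatCover_mul_simple_iff, plo, phi]
    exact hgt.not_gt
  refine ⟨hlt, ?_⟩
  have e1 : heckeLeft i π = simple i * π := by
    rw [heckeLeft, if_pos]
    rw [bruhatCover_simple_mul_iff, pinv, pinv]
    exact h.mono _ _ hylo hlt
  rw [e1, heckeRight] at hact
  by_cases hf : y i.lo = i.lo ∧ y i.hi = i.hi
  · left
    refine ⟨hf.1, hf.2, ?_⟩
    have e2 : muAct μ π i = simple i * π := by
      rw [hact, if_neg]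
      rw [bruhatCover_mul_simple_iff, Perm.mul_apply, Perm.mul_apply, plo, phi, hf.1, hf.2,
        simple_apply_lo, simple_apply_hi]
      exact i.lo_lt_hi.not_gt
    have hcomm : y * simple i = simple i * y := by
      have := swap_mul_eq_mul_swap y i.lo i.hi
      rw [hyinv, hf.1, hf.2] at this
      exact this.symm
    rw [e2]
    refine h.of_same_left ?_ (fun a => ?_) fun a => ?_
    · rw [mul_inv_rev, simple_inv, h.inv_eq, mul_assoc, hcomm]
    · change (simple i * y * (simple i * y)) a = a
      rw [← mul_assoc, mul_assoc (simple i) y, hcomm, ← mul_assoc (simple i), simple_mul_self,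
        one_mul, hyy]
      rfl
    · rw [Perm.mul_apply, hsblk, h.blk]
  · right
    refine ⟨hf, ?_⟩
    have e2 : muAct μ π i = simple i * π * simple r := by
      rw [hact, if_pos]
      rw [bruhatCover_mul_simple_iff, Perm.mul_apply, Perm.mul_apply, plo, phi]
      exact simple_lt_simple hlt hf
    have e3 : simple r = U * simple i * U⁻¹ := by
      rw [simple, rlo, rhi, Equiv.swap_apply_apply]; rfl
    rw [e2]
    refine h.of_same_left ?_ (fun a => ?_) fun a => ?_
    · rw [mul_inv_rev, mul_inv_rev, simple_inv, simple_inv, e3, h.inv_eq]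
      simp only [mul_assoc, inv_mul_cancel_left]
    · simp only [Perm.mul_apply]; rw [simple_simple, h.invol, simple_simple]
    · simp only [Perm.mul_apply]; rw [hsblk, h.blk, hsblk]

/-! ### Atoms satisfy the pattern conditions. -/

theorem foldl_muAct_append_singleton {n : ℕ} (μ : Composition n) (a : List (Letter n))
    (i : Letter n) : (a ++ [i]).foldl (muAct μ) 1 = muAct μ (a.foldl (muAct μ) 1) i := by
  simp

theorem muLen_le {n : ℕ} (μ : Composition n) (a : List (Letter n)) :
    muLen μ (a.foldl (muAct μ) 1) ≤ a.length := Nat.sInf_le ⟨a, rfl, rfl⟩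

theorem exists_muWord_length_eq {n : ℕ} (μ : Composition n) (a : List (Letter n)) :
    ∃ b : List (Letter n), b.foldl (muAct μ) 1 = a.foldl (muAct μ) 1 ∧
      b.length = muLen μ (a.foldl (muAct μ) 1) :=
  Nat.sInf_mem (s := {p | ∃ b : List (Letter n), IsMuWord μ b (a.foldl (muAct μ) 1) ∧
    b.length = p}) ⟨_, a, rfl, rfl⟩

/-- Both kinds of minimality pass to prefixes, so each letter is an ascent of `w` and changes `π`;
one of `relabel`, `conj`, `insert_cycle` then applies. -/
theorem exists_blockForm_of_word {n : ℕ} (μ : Composition n) (a : List (Letter n)) :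
    a.length = len (wordProd a) → a.length = muLen μ (a.foldl (muAct μ) 1) →
    ∃ U y, BlockForm μ (a.foldl (muAct μ) 1) U y ∧
      (∀ x, μ.index (U x) = μ.index (wordProd a x)) ∧ AtomLike μ.index (wordProd a) y := by
  induction a using List.reverseRecOn with
  | nil => exact fun _ _ => ⟨1, 1, BlockForm.one μ, fun _ => rfl, AtomLike.one _⟩
  | append_singleton a i ih =>
    intro h1 h2
    rw [foldl_muAct_append_singleton] at h2 ⊢
    rw [wordProd_append_singleton] at h1 ⊢
    rw [List.length_append, List.length_singleton] at h1 h2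
    set w := wordProd a with hw
    set π := a.foldl (muAct μ) 1 with hπ
    have hwa : len w ≤ a.length := len_wordProd_le a
    have hlt : w i.lo < w i.hi := by
      by_contra h
      have := len_mul_simple_of_gt
        (lt_of_le_of_ne (not_lt.1 h) (w.injective.ne i.lo_lt_hi.ne'))
      omega
    have hl := len_mul_simple hlt
    have hne : muAct μ π i ≠ π := by
      intro e
      rw [e] at h2
      have : muLen μ π ≤ a.length := muLen_le μ a
      omega
    -- A shorter `μ`-word for the prefix, followed by `i`, would shorten the whole word.
    have hm : a.length = muLen μ π := by
      obtain ⟨b, hb, hbl⟩ := exists_muWord_length_eq μ a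
      rw [← hπ] at hbl
      have h3 : muLen μ π ≤ a.length := muLen_le μ a
      have h4 := muLen_le μ (b ++ [i])
      rw [foldl_muAct_append_singleton, hb, ← hπ, List.length_append, List.length_singleton] at h4
      omega
    obtain ⟨U, y, hB, hidx, hP⟩ := ih (by omega) hm
    by_cases hi : μ.index (U i.lo) = μ.index (U i.hi)
    · have hi' : μ.index (w i.lo) = μ.index (w i.hi) := by rw [← hidx, ← hidx, hi]
      have hsblk : ∀ x, μ.index (U x) = μ.index ((w * simple i) x) := by
        intro a
        rw [Perm.mul_apply, hidx]
        by_cases a1 : a = i.lo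
        · subst a1; rw [simple_apply_lo, hi']
        by_cases a2 : a = i.hi
        · subst a2; rw [simple_apply_hi, hi']
        rw [simple_apply_of_ne a1 a2]
      obtain ⟨hy, ⟨hlo, hhi, hB'⟩ | ⟨hf, hB'⟩⟩ := hB.muAct_of_eq hi hne
      · exact ⟨_, _, hB', hsblk, hP.insert_cycle hi' hlt hlo hhi⟩
      · exact ⟨_, _, hB', hsblk, hP.conj hi' hy hf⟩
    · refine ⟨_, _, hB.muAct_of_ne hi hne, fun x => hidx _, ?_⟩
      refine hP.relabel (index_monotone μ) (simple_simple i) fun a b hab hlt => ?_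
      refine simple_lt_simple hlt ?_
      rintro ⟨rfl, rfl⟩
      exact hi (by rw [hidx, hidx, hab])

theorem exists_blockForm_of_mem_muAtoms {n : ℕ} {μ : Composition n} {w π : Perm (Fin n)}
    (h : w ∈ muAtoms μ π) :
    ∃ U y, BlockForm μ π U y ∧ (∀ x, μ.index (U x) = μ.index (w x)) ∧
      AtomLike μ.index w y := by
  obtain ⟨a, ⟨rfl, h1⟩, rfl, h2⟩ := h
  exact exists_blockForm_of_word μ a h1 h2

/-! ### Letters between partners: matchings and counting. -/

section

variable {n : ℕ} {ι : Type*} {g : Fin n → ι}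

theorem eq_block_of_between [PartialOrder ι] (hg : Monotone g) {p q r : Fin n} (h : g p = g r) (hpq : p ≤ q)
    (hqr : q ≤ r) : g q = g r := le_antisymm (hg hqr) (h ▸ hg hpq)

namespace AtomLike

variable {w y z : Perm (Fin n)}

theorem desc_le (hP : AtomLike g w y) {a : Fin n} (h : a ≤ y a) : w (y a) ≤ w a := by
  rcases eq_or_lt_of_le h with h | h
  · rw [← h]
  · exact (hP.desc a h).le

theorem desc' (hP : AtomLike g w y) {a : Fin n} (h : y a < a) : w a < w (y a) := by
  simpa only [hP.invol] using hP.desc (y a) (by rwa [hP.invol])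

theorem between' (hP : AtomLike g w y) {a t : Fin n} (h : y a < t) (h' : t < a) :
    ¬(w a < w t ∧ w t < w (y a)) := by
  simpa only [hP.invol] using hP.between (y a) t h (by rwa [hP.invol])

/-- The cycles occurring between the two letters of a two-cycle enclose it. -/
theorem enclosing [PartialOrder ι] (hg : Monotone g) (hP : AtomLike g w y) {a x : Fin n} (ha : a < y a)
    (h1 : w (y a) < w x) (h2 : w x < w a) :
    ((x < a ∧ y a < y x) ∨ (y a < x ∧ y x < a)) ∧ w (y a) < w (y x) ∧ w (y x) < w a := by
  have hb : g (w x) = g (w a) := eq_block_of_between hg (hP.blk a) h1.le h2.le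
  have hxa : x ≠ a := by rintro rfl; exact lt_irrefl _ h2
  have hxb : x ≠ y a := by rintro rfl; exact lt_irrefl _ h1
  have hyx : y x ≠ a := fun e => hxb (by rw [← e, hP.invol])
  have hyx' : y x ≠ y a := fun e => hxa (y.injective e)
  rcases lt_or_gt_of_ne hxa with h | h
  · have hx : x < y x := by
      by_contra hx
      have hx := not_lt.1 hx
      have h3 := hP.order (y x) a (by rw [hP.blk, hb]) (by rwa [hP.invol]) ha.le
        (hx.trans_lt h) (by rw [hP.invol]; exact h.trans ha)
      rcases eq_or_lt_of_le hx with e | hx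
      · rw [e] at h3; exact lt_asymm h3 h1
      · exact lt_asymm (h1.trans (hP.desc' hx)) h3
    have hd : y a < y x := by
      by_contra hd
      exact lt_asymm h1 (hP.order x a hb hx.le ha.le h (lt_of_le_of_ne (not_lt.1 hd) hyx'))
    refine ⟨Or.inl ⟨h, hd⟩, ?_, (hP.desc x hx).trans h2⟩
    by_contra h3
    exact hP.between x (y a) (h.trans ha) hd
      ⟨lt_of_le_of_ne (not_lt.1 h3) (w.injective.ne hyx'), h1⟩
  · have h : y a < x := by
      by_contra h'
      exact hP.between a x h (lt_of_le_of_ne (not_lt.1 h') hxb) ⟨h1, h2⟩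
    have hx : y x < x := by
      by_contra hx
      have hx := not_lt.1 hx
      have h3 := hP.order a x hb.symm ha.le hx (ha.trans h) (h.trans_le hx)
      exact lt_irrefl _ (h3.trans_le ((hP.desc_le hx).trans h2.le))
    have hd : y x < a := by
      by_contra hd
      have h3 := hP.order a (y x) (by rw [hP.blk, hb]) ha.le (by rw [hP.invol]; exact hx.le)
        (lt_of_le_of_ne (not_lt.1 hd) hyx.symm) (by rwa [hP.invol])
      rw [hP.invol] at h3
      exact lt_asymm h2 h3
    refine ⟨Or.inr ⟨h, hd⟩, h1.trans (hP.desc' hx), ?_⟩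
    by_contra h3
    exact hP.between' hd (ha.trans h)
      ⟨h2, lt_of_le_of_ne (not_lt.1 h3) (w.injective.ne hyx.symm)⟩

/-- If the larger letters occurring from some letter to `a` can be matched with later smaller
letters before `a`, then that letter is not a larger partner of `a`. -/
theorem false_of_matching_before [PartialOrder ι] (hg : Monotone g) (hP : AtomLike g w z) {a : Fin n}
    (ha : a < z a) (ψ : Perm (Fin n))
    (hψ : ∀ x, w (z a) ≤ w x → w x < w a → a < x → ψ x < a ∧ w x < w (ψ x) ∧ w (ψ x) < w a) :
    False := by
  classical
  let L := Finset.univ.filter fun x => (w (z a) < w x ∧ w x < w a) ∧ a < x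
  let S := Finset.univ.filter fun x => (w (z a) < w x ∧ w x < w a) ∧ x < a
  have hd : z a ∉ L := by simp [L]
  have h1 : (insert (z a) L).card ≤ S.card := by
    refine Finset.card_le_card_of_injOn ψ (fun x hx => ?_) ψ.injective.injOn
    have hx' : w (z a) ≤ w x ∧ w x < w a ∧ a < x := by
      rcases Finset.mem_insert.1 hx with rfl | hx
      · exact ⟨le_rfl, hP.desc a ha, ha⟩
      · have := (Finset.mem_filter.1 hx).2
        exact ⟨this.1.1.le, this.1.2, this.2⟩
    have := hψ x hx'.1 hx'.2.1 hx'.2.2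
    exact Finset.mem_filter.2 ⟨Finset.mem_univ _, ⟨hx'.1.trans_lt this.2.1, this.2.2⟩, this.1⟩
  -- By `enclosing`, `z` sends the smaller letters of the interval to larger ones, while `ψ` injects
  -- the larger ones and `z a` into the smaller ones.
  have h2 : S.card ≤ L.card := by
    refine Finset.card_le_card_of_injOn z (fun x hx => ?_) z.injective.injOn
    obtain ⟨⟨h3, h4⟩, h5⟩ := (Finset.mem_filter.1 hx).2
    obtain ⟨h6, h7⟩ := hP.enclosing hg ha h3 h4
    refine Finset.mem_filter.2 ⟨Finset.mem_univ _, h7, ?_⟩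
    rcases h6 with h6 | h6
    · exact ha.trans h6.2
    · exact absurd (ha.trans h6.1) h5.not_gt
  rw [Finset.card_insert_of_notMem hd] at h1
  omega

theorem false_of_matching_after [PartialOrder ι] (hg : Monotone g) (hP : AtomLike g w z) {b : Fin n}
    (hb : z b < b) (φ : Perm (Fin n))
    (hφ : ∀ x, w b < w x → w x ≤ w (z b) → x < b → b < φ x ∧ w b < w (φ x) ∧ w (φ x) < w x) :
    False := by
  classical
  let L := Finset.univ.filter fun x => (w b < w x ∧ w x < w (z b)) ∧ b < x
  let S := Finset.univ.filter fun x => (w b < w x ∧ w x < w (z b)) ∧ x < b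
  have hd : z b ∉ S := by simp [S]
  have h1 : (insert (z b) S).card ≤ L.card := by
    refine Finset.card_le_card_of_injOn φ (fun x hx => ?_) φ.injective.injOn
    have hx' : w b < w x ∧ w x ≤ w (z b) ∧ x < b := by
      rcases Finset.mem_insert.1 hx with rfl | hx
      · exact ⟨hP.desc' hb, le_rfl, hb⟩
      · have := (Finset.mem_filter.1 hx).2
        exact ⟨this.1.1, this.1.2.le, this.2⟩
    have := hφ x hx'.1 hx'.2.1 hx'.2.2
    exact Finset.mem_filter.2
      ⟨Finset.mem_univ _, ⟨this.2.1, this.2.2.trans_le hx'.2.1⟩, this.1⟩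
  have h2 : L.card ≤ S.card := by
    refine Finset.card_le_card_of_injOn z (fun x hx => ?_) z.injective.injOn
    obtain ⟨⟨h3, h4⟩, h5⟩ := (Finset.mem_filter.1 hx).2
    have := hP.enclosing hg (a := z b) (x := x) (by rwa [hP.invol]) (by rwa [hP.invol]) h4
    rw [hP.invol] at this
    obtain ⟨h6, h7⟩ := this
    refine Finset.mem_filter.2 ⟨Finset.mem_univ _, h7, ?_⟩
    rcases h6 with h6 | h6
    · exact absurd (h6.1.trans hb) h5.not_gt
    · exact h6.2.trans hb
  rw [Finset.card_insert_of_notMem hd] at h1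
  omega

/-- By `order`, the cycle of a larger letter `x` preceding `a` cannot be comparable with `a`, so it
surrounds `a` in value; `between` then keeps `a` from separating `x` and `y x` in the word. Thus `y`
supplies the matching of `false_of_matching_before`. -/
theorem before_fixed (hP : AtomLike g w y) {a x : Fin n} (ha : y a = a) (hb : g (w x) = g (w a))
    (h : a < x) (hx : w x < w a) : y x < a ∧ w x < w (y x) ∧ w (y x) < w a := by
  have hxa : y x ≠ a := fun e => h.ne (y.injective (ha.trans e.symm))
  have h1 : y x < x := by
    by_contra h1
    have h1 := not_lt.1 h1
    exact lt_irrefl _ (((hP.order a x hb.symm ha.ge h1 h (by rw [ha]; exact h.trans_le h1)).trans_le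
      (hP.desc_le h1)).trans hx)
  have h2 : y x < a := by
    by_contra h2
    have := hP.order a (y x) (by rw [hP.blk, hb]) ha.ge (by rw [hP.invol]; exact h1.le)
      (lt_of_le_of_ne (not_lt.1 h2) hxa.symm) (by rwa [ha, hP.invol])
    rw [hP.invol] at this
    exact lt_asymm this hx
  refine ⟨h2, hP.desc' h1, ?_⟩
  by_contra h3
  exact hP.between' h2 h ⟨hx, lt_of_le_of_ne (not_lt.1 h3) (w.injective.ne hxa.symm)⟩

theorem after_fixed (hP : AtomLike g w y) {a x : Fin n} (ha : y a = a) (hb : g (w x) = g (w a))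
    (h : x < a) (hx : w a < w x) : a < y x ∧ w a < w (y x) ∧ w (y x) < w x := by
  have hxa : y x ≠ a := fun e => h.ne' (y.injective (ha.trans e.symm))
  have h1 : x < y x := by
    by_contra h1
    have h1 := not_lt.1 h1
    have := hP.order (y x) a (by rw [hP.blk, hb]) (by rwa [hP.invol]) ha.ge (h1.trans_lt h)
      (by rwa [hP.invol, ha])
    rw [ha] at this
    rcases eq_or_lt_of_le h1 with e | h1
    · rw [e] at this; exact lt_asymm this hx
    · exact lt_asymm (hx.trans (hP.desc' h1)) this
  have h2 : a < y x := by
    by_contra h2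
    have := hP.order x a hb h1.le ha.ge h
      (by rw [ha]; exact lt_of_le_of_ne (not_lt.1 h2) hxa)
    rw [ha] at this
    exact lt_asymm this hx
  refine ⟨h2, ?_, hP.desc x h1⟩
  by_contra h3
  exact hP.between x a h h2 ⟨lt_of_le_of_ne (not_lt.1 h3) (w.injective.ne hxa), hx⟩

end AtomLike

/-! ### Swapping along a cover changes nothing off the cycles of `i` and `j`. -/

/-- If `a` is not strictly between `i` and `j` in value, `t_ij` moves no letter across `a`, and the
conjugate of `y` is a matching. Otherwise the cover condition keeps `a` from standing between them
in the word, and `y` itself works. -/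
theorem matching_before_swap {w y : Perm (Fin n)} {i j a D : Fin n} (hij : i < j)
    (hw : w i < w j) (hai : a ≠ i) (haj : a ≠ j)
    (hcov : i < a → a < j → ¬(w i < w a ∧ w a < w j))
    (hQ : ∀ x, D ≤ w x → w x < w a → a < x → y x < a ∧ w x < w (y x) ∧ w (y x) < w a) :
    ∃ ψ : Perm (Fin n), ∀ x, D ≤ w (swap i j x) → w (swap i j x) < w a → a < x →
      ψ x < a ∧ w (swap i j x) < w (swap i j (ψ x)) ∧ w (swap i j (ψ x)) < w a := by
  have hi : swap i j i = j := swap_apply_left _ _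
  have hj : swap i j j = i := swap_apply_right _ _
  have ho : ∀ x, x ≠ i → x ≠ j → swap i j x = x := fun x h h' => swap_apply_of_ne_of_ne h h'
  by_cases hm : i < a ∧ a < j
  · refine ⟨y, fun x h1 h2 h3 => ?_⟩
    have hxi : x ≠ i := by rintro rfl; exact lt_asymm h3 hm.1
    have hya : ∀ x, y x < a → y x ≠ j := fun x h e => lt_asymm hm.2 (e ▸ h)
    by_cases hxj : x = j
    · subst hxj
      rw [hj] at h1 h2 ⊢
      have hja : w x < w a := by
        have := hcov hm.1 hm.2
        by_contra h
        exact this ⟨h2, lt_of_le_of_ne (not_lt.1 h) (w.injective.ne haj)⟩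
      obtain ⟨h4, h5, h6⟩ := hQ x (h1.trans hw.le) hja h3
      have hyi : y x ≠ i := by intro e; rw [e] at h5; exact lt_asymm h5 hw
      rw [ho _ hyi (hya _ h4)]
      exact ⟨h4, hw.trans h5, h6⟩
    · rw [ho x hxi hxj] at h1 h2 ⊢
      obtain ⟨h4, h5, h6⟩ := hQ x h1 h2 h3
      refine ⟨h4, ?_⟩
      by_cases hyi : y x = i
      · rw [hyi] at h5 h6 ⊢
        rw [hi]
        refine ⟨h5.trans hw, ?_⟩
        by_contra h
        exact hcov hm.1 hm.2 ⟨h6, lt_of_le_of_ne (not_lt.1 h) (w.injective.ne haj)⟩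
      · rw [ho _ hyi (hya _ h4)]
        exact ⟨h5, h6⟩
  · refine ⟨swap i j * y * swap i j, fun x h1 h2 h3 => ?_⟩
    have hlt : ∀ x, x < a → swap i j x < a := by
      intro x hx
      by_cases e : x = i
      · rw [e, hi]
        by_contra h
        exact hm ⟨e ▸ hx, lt_of_le_of_ne (not_lt.1 h) haj⟩
      by_cases e' : x = j
      · rw [e', hj]; exact hij.trans (e' ▸ hx)
      rwa [ho x e e']
    have hgt : ∀ x, a < x → a < swap i j x := by
      intro x hx
      by_cases e : x = i
      · rw [e, hi]; exact lt_trans (e ▸ hx) hij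
      by_cases e' : x = j
      · rw [e', hj]
        by_contra h
        exact hm ⟨lt_of_le_of_ne (not_lt.1 h) hai.symm, e' ▸ hx⟩
      rwa [ho x e e']
    simp only [Perm.mul_apply, swap_apply_self]
    obtain ⟨h4, h5⟩ := hQ _ h1 h2 (hgt _ h3)
    exact ⟨hlt _ h4, h5⟩

theorem matching_after_swap {w y : Perm (Fin n)} {i j b D : Fin n} (hij : i < j)
    (hw : w i < w j) (hbi : b ≠ i) (hbj : b ≠ j)
    (hcov : i < b → b < j → ¬(w i < w b ∧ w b < w j))
    (hQ : ∀ x, w b < w x → w x ≤ D → x < b → b < y x ∧ w b < w (y x) ∧ w (y x) < w x) :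
    ∃ φ : Perm (Fin n), ∀ x, w b < w (swap i j x) → w (swap i j x) ≤ D → x < b →
      b < φ x ∧ w b < w (swap i j (φ x)) ∧ w (swap i j (φ x)) < w (swap i j x) := by
  have hi : swap i j i = j := swap_apply_left _ _
  have hj : swap i j j = i := swap_apply_right _ _
  have ho : ∀ x, x ≠ i → x ≠ j → swap i j x = x := fun x h h' => swap_apply_of_ne_of_ne h h'
  by_cases hm : i < b ∧ b < j
  · refine ⟨y, fun x h1 h2 h3 => ?_⟩
    have hxj : x ≠ j := by rintro rfl; exact lt_asymm h3 hm.2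
    have hyb : ∀ x, b < y x → y x ≠ i := fun x h e => lt_asymm hm.1 (e ▸ h)
    by_cases hxi : x = i
    · subst hxi
      rw [hi] at h1 h2 ⊢
      have hib : w b < w x := by
        by_contra h
        exact hcov hm.1 hm.2 ⟨lt_of_le_of_ne (not_lt.1 h) (w.injective.ne hbi.symm), h1⟩
      obtain ⟨h4, h5, h6⟩ := hQ x hib (hw.le.trans h2) h3
      have hyj : y x ≠ j := by intro e; rw [e] at h6; exact lt_asymm h6 hw
      rw [ho _ (hyb _ h4) hyj]
      exact ⟨h4, h5, h6.trans hw⟩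
    · rw [ho x hxi hxj] at h1 h2 ⊢
      obtain ⟨h4, h5, h6⟩ := hQ x h1 h2 h3
      refine ⟨h4, ?_⟩
      by_cases hyj : y x = j
      · rw [hyj] at h5 h6 ⊢
        rw [hj]
        refine ⟨?_, hw.trans h6⟩
        by_contra h
        exact hcov hm.1 hm.2 ⟨lt_of_le_of_ne (not_lt.1 h) (w.injective.ne hbi.symm), h5⟩
      · rw [ho _ (hyb _ h4) hyj]
        exact ⟨h5, h6⟩
  · refine ⟨swap i j * y * swap i j, fun x h1 h2 h3 => ?_⟩
    have hlt : ∀ x, x < b → swap i j x < b := by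
      intro x hx
      by_cases e : x = i
      · rw [e, hi]
        by_contra h
        exact hm ⟨e ▸ hx, lt_of_le_of_ne (not_lt.1 h) hbj⟩
      by_cases e' : x = j
      · rw [e', hj]; exact hij.trans (e' ▸ hx)
      rwa [ho x e e']
    have hgt : ∀ x, b < x → b < swap i j x := by
      intro x hx
      by_cases e : x = i
      · rw [e, hi]; exact lt_trans (e ▸ hx) hij
      by_cases e' : x = j
      · rw [e', hj]
        by_contra h
        exact hm ⟨lt_of_le_of_ne (not_lt.1 h) hbi.symm, e' ▸ hx⟩
      rwa [ho x e e']
    simp only [Perm.mul_apply, swap_apply_self]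
    obtain ⟨h4, h5⟩ := hQ _ h1 h2 (hlt _ h3)
    exact ⟨hgt _ h4, h5⟩

/-- Exchanging the values `i` and `j` in the word of an atom `w` of `y` along a Bruhat cover gives
an atom of `z`. -/
structure AtomSwap (g : Fin n → ι) (i j : Fin n) (w y z : Perm (Fin n)) : Prop where
  lt : i < j
  pos : w i < w j
  cover : ∀ a, i < a → a < j → ¬(w i < w a ∧ w a < w j)
  atom : AtomLike g w y
  atom' : AtomLike g (w * swap i j) z

namespace AtomSwap

variable {w y z : Perm (Fin n)} {i j : Fin n}

theorem apply_of_ne (_h : AtomSwap g i j w y z) {a : Fin n} (hi : a ≠ i) (hj : a ≠ j) :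
    (w * swap i j) a = w a := by
  rw [Perm.mul_apply, swap_apply_of_ne_of_ne hi hj]

theorem not_before [PartialOrder ι] (hg : Monotone g) (h : AtomSwap g i j w y z) {a : Fin n} (hai : a ≠ i)
    (haj : a ≠ j) (hQ : ∀ x, (w * swap i j) (z a) ≤ w x → w x < w a → a < x →
      y x < a ∧ w x < w (y x) ∧ w (y x) < w a) : ¬a < z a := by
  intro ha
  obtain ⟨ψ, hψ⟩ := matching_before_swap h.lt h.pos hai haj (h.cover a) hQ
  refine h.atom'.false_of_matching_before hg ha ψ ?_
  rw [h.apply_of_ne hai haj]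
  exact hψ

theorem not_after [PartialOrder ι] (hg : Monotone g) (h : AtomSwap g i j w y z) {b : Fin n} (hbi : b ≠ i)
    (hbj : b ≠ j) (hQ : ∀ x, w b < w x → w x ≤ (w * swap i j) (z b) → x < b →
      b < y x ∧ w b < w (y x) ∧ w (y x) < w x) : ¬z b < b := by
  intro hb
  obtain ⟨φ, hφ⟩ := matching_after_swap h.lt h.pos hbi hbj (h.cover b) hQ
  refine h.atom'.false_of_matching_after hg hb φ ?_
  rw [h.apply_of_ne hbi hbj]
  exact hφ

theorem apply_of_fixed [PartialOrder ι] (hg : Monotone g) (h : AtomSwap g i j w y z) {a : Fin n} (hai : a ≠ i)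
    (haj : a ≠ j) (ha : y a = a) : z a = a := by
  have hb : g ((w * swap i j) (z a)) = g (w a) := by
    rw [h.atom'.blk, h.apply_of_ne hai haj]
  refine le_antisymm (not_lt.1 (h.not_before hg hai haj fun x h1 h2 h3 => ?_))
    (not_lt.1 (h.not_after hg hai haj fun x h1 h2 h3 => ?_))
  · exact h.atom.before_fixed ha (eq_block_of_between hg hb h1 h2.le) h3 h2
  · exact h.atom.after_fixed ha
      ((eq_block_of_between hg hb.symm h1.le h2).trans hb) h3 h1

theorem apply_of_lt [PartialOrder ι] (hg : Monotone g) (h : AtomSwap g i j w y z) {a : Fin n} (hai : a ≠ i)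
    (haj : a ≠ j) (hbi : y a ≠ i) (hbj : y a ≠ j) (ha : a < y a) : z a = y a := by
  have hP := h.atom'
  have hwa := h.apply_of_ne hai haj
  have hwb := h.apply_of_ne hbi hbj
  have hw := h.atom.desc a ha
  have hblk : g ((w * swap i j) a) = g ((w * swap i j) (y a)) := by rw [hwa, hwb, h.atom.blk]
  -- Otherwise the letters from `z a` up to `a` all lie inside the cycle of `a` in `w`, where
  -- `enclosing` matches larger with smaller ones, against the counting.
  have A : a < z a → (w * swap i j) (z a) ≤ w (y a) := by
    intro h1
    by_contra h2
    have h2 := not_le.1 h2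
    refine h.not_before hg hai haj (fun x h3 h4 h5 => ?_) h1
    obtain ⟨h6 | h6, h7⟩ := h.atom.enclosing hg ha (h2.trans_le h3) h4
    · exact absurd h5 h6.1.not_gt
    · exact ⟨h6.2, h.atom.desc' (h6.2.trans h5), h7.2⟩
  have B : z (y a) < y a → w a ≤ (w * swap i j) (z (y a)) := by
    intro h1
    by_contra h2
    have h2 := not_le.1 h2
    refine h.not_after hg hbi hbj (fun x h3 h4 h5 => ?_) h1
    obtain ⟨h6 | h6, h7⟩ := h.atom.enclosing hg ha h3 (h4.trans_lt h2)
    · exact ⟨h6.2, h7.1, h.atom.desc x ((h6.1.trans ha).trans h6.2)⟩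
    · exact absurd h5 h6.1.not_gt
  rw [← hwb] at A
  rw [← hwa] at B
  rw [← hwa, ← hwb] at hw
  -- From here only `z` and the new word matter: `b` precedes `a`, and `A`, `B` bound the positions
  -- of their partners. Unless `z a = b`, either `order` fails or one of `a`, `b` lies inside the
  -- cycle of the other.
  generalize w * swap i j = w' at *
  generalize y a = b at *
  by_contra hne
  have hne' : z b ≠ a := fun e => hne (by rw [← e, hP.invol])
  have hzab : z a ≠ z b := z.injective.ne ha.ne
  rcases le_or_gt b (z b) with h1 | h1
  · have h2 : a < z a := by
      by_contra h2
      have h2 := not_lt.1 h2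
      have h3 := hP.order (z a) b (by rw [hP.blk, hblk]) (by rwa [hP.invol]) h1
        (h2.trans_lt ha) (by rw [hP.invol]; exact ha.trans_le h1)
      have h4 : w' a ≤ w' (z a) := by
        simpa only [hP.invol] using hP.desc_le (a := z a) (by rwa [hP.invol])
      exact lt_irrefl _ (((h4.trans_lt h3).trans_le (hP.desc_le h1)).trans hw)
    have h3 : z b < z a := by
      by_contra h3
      exact lt_irrefl _ (((hP.order a b hblk h2.le h1 ha
        (lt_of_le_of_ne (not_lt.1 h3) hzab)).trans_le (hP.desc_le h1)).trans hw)
    exact hP.between a b ha (h1.trans_lt h3)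
      ⟨lt_of_le_of_ne (A h2) (w'.injective.ne hne), hw⟩
  · have h2 : w' a < w' (z b) := lt_of_le_of_ne (B h1) (w'.injective.ne hne'.symm)
    have h3 : a < z b := by
      by_contra h3
      exact hP.between' (lt_of_le_of_ne (not_lt.1 h3) hne') ha ⟨hw, h2⟩
    have h4 : a < z a := by
      by_contra h4
      have h4 := not_lt.1 h4
      have h5 := hP.order (z a) (z b) (by rw [hP.blk, hP.blk, hblk]) (by rwa [hP.invol])
        (by rw [hP.invol]; exact h1.le) (h4.trans_lt h3) (by rwa [hP.invol, hP.invol])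
      rw [hP.invol] at h5
      have h6 : w' a ≤ w' (z a) := by
        simpa only [hP.invol] using hP.desc_le (a := z a) (by rwa [hP.invol])
      exact lt_irrefl _ ((h6.trans_lt h5).trans hw)
    have h5 : w' (z a) < w' b := lt_of_le_of_ne (A h4) (w'.injective.ne hne)
    rcases lt_or_gt_of_ne hne with h6 | h6
    · have h7 := hP.order a (z b) (by rw [hP.blk, hblk]) h4.le (by rw [hP.invol]; exact h1.le) h3
        (by rwa [hP.invol])
      rw [hP.invol] at h7
      exact lt_asymm hw h7
    · exact hP.between a b ha h6 ⟨h5, hw⟩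

/-- `z` agrees with `y` outside the cycles of `i` and `j`. -/
theorem apply_eq [PartialOrder ι] (hg : Monotone g) (h : AtomSwap g i j w y z) {a : Fin n} (hai : a ≠ i)
    (haj : a ≠ j) (hbi : y a ≠ i) (hbj : y a ≠ j) : z a = y a := by
  rcases lt_trichotomy a (y a) with h1 | h1 | h1
  · exact h.apply_of_lt hg hai haj hbi hbj h1
  · rw [← h1]; exact h.apply_of_fixed hg hai haj h1.symm
  · have := h.apply_of_lt hg (a := y a) hbi hbj (by rwa [h.atom.invol]) (by rwa [h.atom.invol])
      (by rwa [h.atom.invol])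
    rw [h.atom.invol] at this
    conv_lhs => rw [← this, h.atom'.invol]

end AtomSwap


end

/-! ### Patterns on three and four letters. -/

theorem exists_sorted_of_card_eq_three {n : ℕ} {C : Finset (Fin n)} (h : C.card = 3) :
    ∃ p q r, p < q ∧ q < r ∧ ∀ x, x ∈ C ↔ x = p ∨ x = q ∨ x = r := by
  refine ⟨C.orderEmbOfFin h 0, C.orderEmbOfFin h 1, C.orderEmbOfFin h 2,
    (C.orderEmbOfFin h).strictMono (by decide), (C.orderEmbOfFin h).strictMono (by decide),
    fun x => ?_⟩
  rw [← Finset.mem_coe, ← Finset.range_orderEmbOfFin C h, Set.mem_range, Fin.exists_fin_succ,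
    Fin.exists_fin_succ, Fin.exists_fin_one]
  simp only [eq_comm (a := x)]
  rfl

theorem exists_sorted_of_card_eq_four {n : ℕ} {C : Finset (Fin n)} (h : C.card = 4) :
    ∃ p q r s, p < q ∧ q < r ∧ r < s ∧ ∀ x, x ∈ C ↔ x = p ∨ x = q ∨ x = r ∨ x = s := by
  refine ⟨C.orderEmbOfFin h 0, C.orderEmbOfFin h 1, C.orderEmbOfFin h 2, C.orderEmbOfFin h 3,
    (C.orderEmbOfFin h).strictMono (by decide), (C.orderEmbOfFin h).strictMono (by decide),
    (C.orderEmbOfFin h).strictMono (by decide), fun x => ?_⟩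
  rw [← Finset.mem_coe, ← Finset.range_orderEmbOfFin C h, Set.mem_range, Fin.exists_fin_succ,
    Fin.exists_fin_succ, Fin.exists_fin_succ, Fin.exists_fin_one]
  simp only [eq_comm (a := x)]
  rfl

namespace AtomLike

variable {n : ℕ} {ι : Type*} {g : Fin n → ι} {w y z : Perm (Fin n)}

theorem lt_of_cycles (hP : AtomLike g w z) {a b c d : Fin n} (ha : z a = b) (hc : z c = d)
    (hg : g (w a) = g (w c)) (hab : a ≤ b) (hcd : c ≤ d) (hac : a < c) (hbd : b < d) :
    w a < w d := by
  subst ha hc; exact hP.order a c hg hab hcd hac hbd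

theorem not_between_cycle (hP : AtomLike g w z) {a b t : Fin n} (ha : z a = b) (hat : a < t)
    (htb : t < b) : w t < w b ∨ w a < w t := by
  subst ha
  by_contra! h
  exact hP.between a t hat htb ⟨lt_of_le_of_ne h.1 (w.injective.ne htb.ne'),
    lt_of_le_of_ne h.2 (w.injective.ne hat.ne')⟩

theorem lt_of_cycle (hP : AtomLike g w z) {a b : Fin n} (ha : z a = b) (hab : a < b) :
    w b < w a := by
  subst ha; exact hP.desc a hab

theorem apply_symm (hP : AtomLike g w z) {a b : Fin n} (ha : z a = b) : z b = a := by
  subst ha; exact hP.invol a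

theorem on_two (hP : AtomLike g w z) {p q : Fin n} (hpq : p < q) (hb : g (w p) = g (w q))
    (hp : z p = p ∨ z p = q) (hq : z q = p ∨ z q = q) :
    (z p = p ∧ w p < w q) ∨ (z p = q ∧ w q < w p) := by
  rcases hp with hp | hp
  · have hq' : z q = q := hq.resolve_left fun e => hpq.ne (z.injective (hp.trans e.symm))
    exact Or.inl ⟨hp, hP.lt_of_cycles hp hq' hb le_rfl le_rfl hpq hpq⟩
  · exact Or.inr ⟨hp, hP.lt_of_cycle hp hpq⟩

theorem on_three (hP : AtomLike g w z) {p q r : Fin n} (hpq : p < q) (hqr : q < r)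
    (h1 : g (w p) = g (w q)) (h2 : g (w q) = g (w r))
    (hz : ∀ x, x = p ∨ x = q ∨ x = r → z x = p ∨ z x = q ∨ z x = r) :
    (z p = p ∧ z q = q ∧ z r = r ∧ w p < w q ∧ w q < w r) ∨
    (z p = q ∧ z q = p ∧ z r = r ∧ w q < w p ∧ w p < w r) ∨
    (z p = p ∧ z q = r ∧ z r = q ∧ w p < w r ∧ w r < w q) ∨
    (z p = r ∧ z q = q ∧ z r = p ∧ w r < w p ∧ (w q < w r ∨ w p < w q)) := by
  have hp := hz p (by simp)
  have hq := hz q (by simp)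
  have hr := hz r (by simp)
  have h3 := h1.trans h2
  have hpr := hpq.trans hqr
  have inj : ∀ {a b c}, z a = c → z b = c → a = b := fun h h' => z.injective (h.trans h'.symm)
  rcases hp with hp | hp | hp
  · rcases hq with hq | hq | hq
    · exact absurd (inj hp hq) hpq.ne
    · rcases hr with hr | hr | hr
      · exact absurd (inj hp hr) hpr.ne
      · exact absurd (inj hq hr) hqr.ne
      · exact Or.inl ⟨hp, hq, hr, hP.lt_of_cycles hp hq h1 le_rfl le_rfl hpq hpq,
          hP.lt_of_cycles hq hr h2 le_rfl le_rfl hqr hqr⟩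
    · have hr' := hP.apply_symm hq
      exact Or.inr (Or.inr (Or.inl ⟨hp, hq, hr',
        hP.lt_of_cycles hp hq h1 le_rfl hqr.le hpq hpr, hP.lt_of_cycle hq hqr⟩))
  · have hq' := hP.apply_symm hp
    rcases hr with hr | hr | hr
    · exact absurd (inj hq' hr) hqr.ne
    · exact absurd (inj hp hr) hpr.ne
    · exact Or.inr (Or.inl ⟨hp, hq', hr, hP.lt_of_cycle hp hpq,
        hP.lt_of_cycles hp hr h3 hpq.le le_rfl hpr hqr⟩)
  · have hr' := hP.apply_symm hp
    rcases hq with hq | hq | hq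
    · exact absurd (inj hr' hq) hqr.ne'
    · exact Or.inr (Or.inr (Or.inr ⟨hp, hq, hr', hP.lt_of_cycle hp hpr,
        hP.not_between_cycle hp hpq hqr⟩))
    · exact absurd (inj hp hq) hpq.ne

/-- One disjunct per involution of four letters, with the linear inequalities on positions that it
forces, in a form `omega` can use. -/
theorem on_four (hP : AtomLike g w z) {p q r s : Fin n} (hpq : p < q) (hqr : q < r) (hrs : r < s)
    (h1 : g (w p) = g (w q)) (h2 : g (w q) = g (w r)) (h3 : g (w r) = g (w s))
    (hz : ∀ x, x = p ∨ x = q ∨ x = r ∨ x = s → z x = p ∨ z x = q ∨ z x = r ∨ z x = s) :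
    (z p = p ∧ z q = q ∧ z r = r ∧ z s = s ∧ w p < w q ∧ w q < w r ∧ w r < w s) ∨
    (z p = q ∧ z q = p ∧ z r = r ∧ z s = s ∧ w q < w p ∧ w p < w r ∧ w r < w s) ∨
    (z p = p ∧ z q = r ∧ z r = q ∧ z s = s ∧ w p < w r ∧ w r < w q ∧ w q < w s) ∨
    (z p = p ∧ z q = q ∧ z r = s ∧ z s = r ∧ w p < w q ∧ w q < w s ∧ w s < w r) ∨
    (z p = r ∧ z q = q ∧ z r = p ∧ z s = s ∧ w r < w p ∧ (w q < w r ∨ w p < w q) ∧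
      w p < w s ∧ w q < w s) ∨
    (z p = p ∧ z q = s ∧ z r = r ∧ z s = q ∧ w s < w q ∧ (w r < w s ∨ w q < w r) ∧
      w p < w s ∧ w p < w r) ∨
    (z p = s ∧ z q = q ∧ z r = r ∧ z s = p ∧ w s < w p ∧ (w q < w s ∨ w p < w q) ∧
      (w r < w s ∨ w p < w r) ∧ w q < w r) ∨
    (z p = q ∧ z q = p ∧ z r = s ∧ z s = r ∧ w q < w p ∧ w p < w s ∧ w s < w r) ∨
    (z p = r ∧ z q = s ∧ z r = p ∧ z s = q ∧ w r < w p ∧ w p < w s ∧ w s < w q) ∨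
    (z p = s ∧ z q = r ∧ z r = q ∧ z s = p ∧ w s < w p ∧ w r < w q ∧
      (w q < w s ∨ w p < w q) ∧ (w r < w s ∨ w p < w r)) := by
  have hp := hz p (by simp)
  have hq := hz q (by simp)
  have hr := hz r (by simp)
  have hs := hz s (by simp)
  have h13 := h1.trans h2
  have h24 := h2.trans h3
  have h14 := h13.trans h3
  have hpr := hpq.trans hqr
  have hqs := hqr.trans hrs
  have hps := hpr.trans hrs
  have inj : ∀ {a b c}, z a = c → z b = c → a = b := fun h h' => z.injective (h.trans h'.symm)
  have npq : z p ≠ z q := z.injective.ne hpq.ne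
  have npr : z p ≠ z r := z.injective.ne hpr.ne
  have nps : z p ≠ z s := z.injective.ne hps.ne
  have nqr : z q ≠ z r := z.injective.ne hqr.ne
  have nqs : z q ≠ z s := z.injective.ne hqs.ne
  have nrs : z r ≠ z s := z.injective.ne hrs.ne
  rcases hp with hp | hp | hp | hp
  · rcases hq with hq | hq | hq | hq
    · exact absurd (hp.trans hq.symm) npq
    · rcases hr with hr | hr | hr | hr
      · exact absurd (hp.trans hr.symm) npr
      · exact absurd (hq.trans hr.symm) nqr
      · have hs : z s = s := by grind
        have := hP.lt_of_cycles hp hq h1 le_rfl le_rfl hpq hpq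
        have := hP.lt_of_cycles hq hr h2 le_rfl le_rfl hqr hqr
        have := hP.lt_of_cycles hr hs h3 le_rfl le_rfl hrs hrs
        exact Or.inl ⟨hp, hq, hr, hs, ‹_›, ‹_›, ‹_›⟩
      · have hs := hP.apply_symm hr
        have := hP.lt_of_cycles hp hq h1 le_rfl le_rfl hpq hpq
        have := hP.lt_of_cycles hq hr h2 le_rfl hrs.le hqr hqs
        have := hP.lt_of_cycle hr hrs
        exact Or.inr (Or.inr (Or.inr (Or.inl ⟨hp, hq, hr, hs, ‹_›, ‹_›, ‹_›⟩)))
    · have hr := hP.apply_symm hq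
      have hs : z s = s := by grind
      have := hP.lt_of_cycles hp hq h1 le_rfl hqr.le hpq hpr
      have := hP.lt_of_cycle hq hqr
      have := hP.lt_of_cycles hq hs h24 hqr.le le_rfl hqs hrs
      exact Or.inr (Or.inr (Or.inl ⟨hp, hq, hr, hs, ‹_›, ‹_›, ‹_›⟩))
    · have hs := hP.apply_symm hq
      have hr : z r = r := by grind
      have := hP.lt_of_cycles hp hq h1 le_rfl hqs.le hpq hps
      have := hP.lt_of_cycles hp hr h13 le_rfl le_rfl hpr hpr
      have := hP.lt_of_cycle hq hqs
      have := hP.not_between_cycle hq hqr hrs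
      exact Or.inr (Or.inr (Or.inr (Or.inr (Or.inr (Or.inl ⟨hp, hq, hr, hs, ‹_›, ‹_›, ‹_›, ‹_›⟩)))))
  · have hq := hP.apply_symm hp
    have := hP.lt_of_cycle hp hpq
    rcases hr with hr | hr | hr | hr
    · exact absurd (hq.trans hr.symm) nqr
    · exact absurd (hp.trans hr.symm) npr
    · have hs : z s = s := by grind
      have := hP.lt_of_cycles hp hr h13 hpq.le le_rfl hpr hqr
      have := hP.lt_of_cycles hr hs h3 le_rfl le_rfl hrs hrs
      exact Or.inr (Or.inl ⟨hp, hq, hr, hs, ‹_›, ‹_›, ‹_›⟩)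
    · have hs := hP.apply_symm hr
      have := hP.lt_of_cycles hp hr h13 hpq.le hrs.le hpr hqs
      have := hP.lt_of_cycle hr hrs
      exact Or.inr (Or.inr (Or.inr (Or.inr (Or.inr (Or.inr (Or.inr (Or.inl ⟨hp, hq, hr, hs, ‹_›, ‹_›, ‹_›⟩)))))))
  · have hr := hP.apply_symm hp
    have := hP.lt_of_cycle hp hpr
    rcases hq with hq | hq | hq | hq
    · exact absurd (hq.trans hr.symm) nqr
    · have hs : z s = s := by grind
      have := hP.not_between_cycle hp hpq hqr
      have := hP.lt_of_cycles hp hs h14 hpr.le le_rfl hps hrs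
      have := hP.lt_of_cycles hq hs h24 le_rfl le_rfl hqs hqs
      exact Or.inr (Or.inr (Or.inr (Or.inr (Or.inl ⟨hp, hq, hr, hs, ‹_›, ‹_›, ‹_›, ‹_›⟩))))
    · exact absurd (hp.trans hq.symm) npq
    · have hs := hP.apply_symm hq
      have := hP.lt_of_cycles hp hq h1 hpr.le hqs.le hpq hrs
      have := hP.lt_of_cycle hq hqs
      exact Or.inr (Or.inr (Or.inr (Or.inr (Or.inr (Or.inr (Or.inr (Or.inr (Or.inl ⟨hp, hq, hr, hs, ‹_›, ‹_›, ‹_›⟩))))))))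
  · have hs := hP.apply_symm hp
    have := hP.lt_of_cycle hp hps
    have := hP.not_between_cycle hp hpq hqs
    have := hP.not_between_cycle hp hpr hrs
    rcases hq with hq | hq | hq | hq
    · exact absurd (hq.trans hs.symm) nqs
    · have hr : z r = r := by grind
      have := hP.lt_of_cycles hq hr h2 le_rfl le_rfl hqr hqr
      exact Or.inr (Or.inr (Or.inr (Or.inr (Or.inr (Or.inr (Or.inl ⟨hp, hq, hr, hs, ‹_›, ‹_›, ‹_›, ‹_›⟩))))))
    · have hr := hP.apply_symm hq
      have := hP.lt_of_cycle hq hqr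
      exact Or.inr (Or.inr (Or.inr (Or.inr (Or.inr (Or.inr (Or.inr (Or.inr (Or.inr (⟨hp, hq, hr, hs, ‹_›, ‹_›, ‹_›, ‹_›⟩)))))))))
    · exact absurd (hp.trans hq.symm) npq

end AtomLike

namespace AtomSwap

variable {n : ℕ} {ι : Type*} {g : Fin n → ι} {i j : Fin n}
  {w y z : Perm (Fin n)}

/-- `hyi` excludes the identity on these letters, which would give `t_ij` instead. -/
theorem apply_on_three (h : AtomSwap g i j w y z) {p q r : Fin n}
    (hpq : p < q) (hqr : q < r) (hi : i = p ∨ i = q ∨ i = r) (hj : j = p ∨ j = q ∨ j = r)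
    (hy : ∀ x, x = p ∨ x = q ∨ x = r → y x = p ∨ y x = q ∨ y x = r)
    (hz : ∀ x, x = p ∨ x = q ∨ x = r → z x = p ∨ z x = q ∨ z x = r)
    (hpq' : g (w p) = g (w q)) (hqr' : g (w q) = g (w r))
    (hyi : y i = i → y j ≠ j) : z p = r ∧ z q = q ∧ z r = p := by
  have hlt := h.lt
  have hpos := h.pos
  have hcov := h.cover
  have Y := h.atom.on_three hpq hqr hpq' hqr' hy
  have Z := h.atom'.on_three hpq hqr
  have hpr := hpq.trans hqr
  have ho : ∀ x, x ≠ i → x ≠ j → swap i j x = x := fun x h h' => swap_apply_of_ne_of_ne h h'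
  rcases hi with rfl | rfl | rfl <;> rcases hj with rfl | rfl | rfl <;>
    first
    | exact absurd hlt (lt_irrefl _)
    | exact absurd hlt (by assumption : _ < _).not_gt
    | skip
  · simp only [Perm.mul_apply, swap_apply_left, swap_apply_right,
      swap_apply_of_ne_of_ne hpr.ne' hqr.ne'] at Z
    replace Z := Z hpq'.symm (by rw [hpq', hqr']) hz
    rcases Y with Y | Y | Y | Y <;> omega
  · simp only [Perm.mul_apply, swap_apply_left, swap_apply_right,
      swap_apply_of_ne_of_ne hpq.ne' hqr.ne] at Z
    replace Z := Z hqr'.symm hpq'.symm hz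
    have := hcov _ hpq hqr
    rcases Y with Y | Y | Y | Y <;> omega
  · simp only [Perm.mul_apply, swap_apply_left, swap_apply_right,
      swap_apply_of_ne_of_ne hpq.ne hpr.ne] at Z
    replace Z := Z (by rw [hpq', hqr']) hqr'.symm hz
    rcases Y with Y | Y | Y | Y <;> omega

/-- The disjuncts are separated by conditions on `i`, `j` and `y` only, so the outcome does not
depend on `w`. -/
theorem apply_on_four (h : AtomSwap g i j w y z) {p q r s : Fin n}
    (hpq : p < q) (hqr : q < r) (hrs : r < s) (hi : i = p ∨ i = q ∨ i = r ∨ i = s)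
    (hj : j = p ∨ j = q ∨ j = r ∨ j = s)
    (hy : ∀ x, x = p ∨ x = q ∨ x = r ∨ x = s → y x = p ∨ y x = q ∨ y x = r ∨ y x = s)
    (hz : ∀ x, x = p ∨ x = q ∨ x = r ∨ x = s → z x = p ∨ z x = q ∨ z x = r ∨ z x = s)
    (hpq' : g (w p) = g (w q)) (hqr' : g (w q) = g (w r)) (hrs' : g (w r) = g (w s))
    (hyp : y p ≠ p) (hyq : y q ≠ q) (hyr : y r ≠ r) (hyij : y i ≠ j) :
    (i = q ∧ j = r ∧ y p = q ∧ z p = r ∧ z q = s ∧ z r = p ∧ z s = q) ∨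
    (¬(i = q ∧ j = r ∧ y p = q) ∧ z p = s ∧ z s = p ∧
      ((y p = r ∧ z q = r ∧ z r = q) ∨ (y p ≠ r ∧ z q = q ∧ z r = r))) := by
  have hlt := h.lt
  have hpos := h.pos
  have hcov := h.cover
  have Y := h.atom.on_four hpq hqr hrs hpq' hqr' hrs' hy
  have Z := h.atom'.on_four hpq hqr hrs
  have hpr := hpq.trans hqr
  have hqs := hqr.trans hrs
  have hps := hpr.trans hrs
  replace Y : (y p = q ∧ y q = p ∧ y r = s ∧ y s = r ∧ w q < w p ∧ w p < w s ∧ w s < w r) ∨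
    (y p = r ∧ y q = s ∧ y r = p ∧ y s = q ∧ w r < w p ∧ w p < w s ∧ w s < w q) ∨
    (y p = s ∧ y q = r ∧ y r = q ∧ y s = p ∧ w s < w p ∧ w r < w q ∧
      (w q < w s ∨ w p < w q) ∧ (w r < w s ∨ w p < w r)) := by
    simpa only [hyp, hyq, hyr, false_and, and_false, false_or] using Y
  rcases hi with rfl | rfl | rfl | rfl <;> rcases hj with rfl | rfl | rfl | rfl <;>
    first
    | exact absurd hlt (lt_irrefl _)
    | exact absurd hlt (by assumption : _ < _).not_gt
    | skip
  · simp only [Perm.mul_apply, swap_apply_left, swap_apply_right,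
      swap_apply_of_ne_of_ne hpr.ne' hqr.ne', swap_apply_of_ne_of_ne hps.ne' hqs.ne'] at Z
    clear hcov
    -- Matchings `y` incompatible with `w i < w j` and `y i ≠ j` drop out; the others are tested
    -- against all ten patterns for `z`.
    rcases Y with Y | Y | Y <;> try omega
    all_goals
      replace Z := Z hpq'.symm (hpq'.trans hqr') hrs' hz
      rcases Z with Z | Z | Z | Z | Z | Z | Z | Z | Z | Z <;>
        first | (exfalso; omega) | omega
  · simp only [Perm.mul_apply, swap_apply_left, swap_apply_right,
      swap_apply_of_ne_of_ne hpq.ne' hqr.ne, swap_apply_of_ne_of_ne hps.ne' hrs.ne'] at Z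
    have := hcov _ hpq hqr
    clear hcov
    rcases Y with Y | Y | Y <;> try omega
    all_goals
      replace Z := Z hqr'.symm hpq'.symm (by rw [hpq', hqr', hrs']) hz
      rcases Z with Z | Z | Z | Z | Z | Z | Z | Z | Z | Z <;>
        first | (exfalso; omega) | omega
  · simp only [Perm.mul_apply, swap_apply_left, swap_apply_right,
      swap_apply_of_ne_of_ne hpq.ne' hqs.ne, swap_apply_of_ne_of_ne hpr.ne' hrs.ne] at Z
    have := hcov _ hpq hqs
    have := hcov _ hpr hrs
    clear hcov
    rcases Y with Y | Y | Y <;> try omega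
    all_goals
      replace Z := Z (by rw [hqr', hrs']) hqr' (by rw [hpq', hqr']) hz
      rcases Z with Z | Z | Z | Z | Z | Z | Z | Z | Z | Z <;>
        first | (exfalso; omega) | omega
  · simp only [Perm.mul_apply, swap_apply_left, swap_apply_right,
      swap_apply_of_ne_of_ne hpq.ne hpr.ne, swap_apply_of_ne_of_ne hqs.ne' hrs.ne'] at Z
    clear hcov
    rcases Y with Y | Y | Y <;> try omega
    all_goals
      replace Z := Z (by rw [hpq', hqr']) hqr'.symm (by rw [hqr', hrs']) hz
      rcases Z with Z | Z | Z | Z | Z | Z | Z | Z | Z | Z <;>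
        first | (exfalso; omega) | omega
  · simp only [Perm.mul_apply, swap_apply_left, swap_apply_right,
      swap_apply_of_ne_of_ne hpq.ne hps.ne, swap_apply_of_ne_of_ne hqr.ne' hrs.ne] at Z
    have := hcov _ hqr hrs
    clear hcov
    rcases Y with Y | Y | Y <;> try omega
    all_goals
      replace Z := Z (by rw [hpq', hqr', hrs']) hrs'.symm hqr'.symm hz
      rcases Z with Z | Z | Z | Z | Z | Z | Z | Z | Z | Z <;>
        first | (exfalso; omega) | omega
  · simp only [Perm.mul_apply, swap_apply_left, swap_apply_right,
      swap_apply_of_ne_of_ne hpr.ne hps.ne, swap_apply_of_ne_of_ne hqr.ne hqs.ne] at Z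
    clear hcov
    rcases Y with Y | Y | Y <;> try omega
    all_goals
      replace Z := Z hpq' (by rw [hqr', hrs']) hrs'.symm hz
      rcases Z with Z | Z | Z | Z | Z | Z | Z | Z | Z | Z <;>
        first | (exfalso; omega) | omega

end AtomSwap

/-! ### The involution `z` on the cycles of `i` and `j`. -/

theorem AtomLike.on_pair {n : ℕ} {ι : Type*} {g : Fin n → ι} {w z : Perm (Fin n)}
    (hP : AtomLike g w z) {a b : Fin n} (hab : a ≠ b) (hblk : g (w a) = g (w b))
    (ha : z a = a ∨ z a = b) (hb : z b = a ∨ z b = b) :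
    ((a < b ↔ w a < w b) ∧ z a = a ∧ z b = b) ∨ ((a < b ↔ w b < w a) ∧ z a = b ∧ z b = a) := by
  have hz : z a ≠ z b := z.injective.ne hab
  rcases lt_or_gt_of_ne hab with h | h
  · rcases hP.on_two h hblk ha hb with h1 | h1 <;> omega
  · rcases hP.on_two h hblk.symm hb.symm ha.symm with h1 | h1 <;> omega

namespace AtomSwap

variable {n : ℕ} {ι : Type*} {g : Fin n → ι} {i j : Fin n}
  {w y z : Perm (Fin n)}

theorem apply_left (_h : AtomSwap g i j w y z) : (w * swap i j) i = w j := by simp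

theorem apply_right (_h : AtomSwap g i j w y z) : (w * swap i j) j = w i := by simp

/-- If `z x` lay outside, `apply_eq` there would give `x = y (z x)`, so `z x = y x`, which is
inside. -/
theorem cycles_closed [PartialOrder ι] (hg : Monotone g) (h : AtomSwap g i j w y z) {x : Fin n}
    (hx : x = i ∨ x = j ∨ x = y i ∨ x = y j) :
    z x = i ∨ z x = j ∨ z x = y i ∨ z x = y j := by
  have hy := h.atom.invol
  by_contra! hne
  have e := h.apply_eq hg hne.1 hne.2.1 (fun e => hne.2.2.1 (by rw [← e, hy]))
    (fun e => hne.2.2.2 (by rw [← e, hy]))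
  rw [h.atom'.invol] at e
  have e' : z x = y x := by rw [e, hy, ← e]
  rw [e'] at hne
  rcases hx with rfl | rfl | rfl | rfl
  · exact hne.2.2.1 rfl
  · exact hne.2.2.2 rfl
  · exact hne.1 (hy _)
  · exact hne.2.1 (hy _)

theorem apply_ne (h : AtomSwap g i j w y z) : y i ≠ j := fun e =>
  lt_asymm h.pos (e ▸ h.atom.desc i (by rw [e]; exact h.lt))

theorem mem_of_block_ne (h : AtomSwap g i j w y z) {a b x : Fin n}
    (hab : (a = i ∧ b = j) ∨ (a = j ∧ b = i)) (hb : g (w i) ≠ g (w j))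
    (hx : x = i ∨ x = j ∨ x = y i ∨ x = y j) (hxb : g ((w * swap i j) x) = g (w b)) :
    x = a ∨ (x = y b ∧ y b ≠ b) := by
  have hki := h.atom.blk i
  have hlj := h.atom.blk j
  have hi := h.apply_left
  have hj := h.apply_right
  by_cases h1 : x = i
  · subst h1
    rw [hi] at hxb
    rcases hab with ⟨rfl, rfl⟩ | ⟨rfl, rfl⟩
    · exact Or.inl rfl
    · exact absurd hxb.symm hb
  by_cases h2 : x = j
  · subst h2
    rw [hj] at hxb
    rcases hab with ⟨rfl, rfl⟩ | ⟨rfl, rfl⟩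
    · exact absurd hxb hb
    · exact Or.inl rfl
  rw [h.apply_of_ne h1 h2] at hxb
  right
  rcases hx with hx | hx | hx | hx
  · exact absurd hx h1
  · exact absurd hx h2
  · subst hx
    rcases hab with ⟨rfl, rfl⟩ | ⟨rfl, rfl⟩
    · rw [hki] at hxb; exact absurd hxb hb
    · exact ⟨rfl, h1⟩
  · subst hx
    rcases hab with ⟨rfl, rfl⟩ | ⟨rfl, rfl⟩
    · exact ⟨rfl, h2⟩
    · rw [hlj] at hxb; exact absurd hxb.symm hb

/-- The letter `a` takes the place of `b`. Its order relative to `y b` differs from that of `b`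
exactly when `i < y b < j`; then the pair becomes ascending and splits into fixed points, and
otherwise `a` inherits the partner. -/
theorem apply_of_block_ne [PartialOrder ι] (hg : Monotone g) (h : AtomSwap g i j w y z) {a b : Fin n}
    (hab : (a = i ∧ b = j) ∨ (a = j ∧ b = i)) (hb : g (w i) ≠ g (w j)) :
    (y b = b ∧ z a = a) ∨ (y b ≠ b ∧ (i < y b ∧ y b < j) ∧ z a = a ∧ z (y b) = y b) ∨
      (y b ≠ b ∧ ¬(i < y b ∧ y b < j) ∧ z a = y b ∧ z (y b) = a) := by
  have hij := h.lt
  have hmem : ∀ x, x = i ∨ x = j ∨ x = y i ∨ x = y j → g ((w * swap i j) x) = g (w b) →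
      z x = a ∨ (z x = y b ∧ y b ≠ b) := fun x hx hxb =>
    h.mem_of_block_ne hab hb (h.cycles_closed hg hx) (by rw [h.atom'.blk, hxb])
  have hwa : (w * swap i j) a = w b := by
    rcases hab with ⟨rfl, rfl⟩ | ⟨rfl, rfl⟩
    · exact h.apply_left
    · exact h.apply_right
  have hza := hmem a (by tauto) (by rw [hwa])
  by_cases hk : y b = b
  · exact Or.inl ⟨hk, hza.resolve_right fun e => e.2 hk⟩
  right
  have hbk := h.atom.blk b
  have hba : g (w b) ≠ g (w a) := by
    rcases hab with ⟨rfl, rfl⟩ | ⟨rfl, rfl⟩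
    · exact hb.symm
    · exact hb
  have hka : y b ≠ a := fun e => hba (by rw [← hbk, e])
  have hwk : (w * swap i j) (y b) = w (y b) := by
    rcases hab with ⟨rfl, rfl⟩ | ⟨rfl, rfl⟩
    · exact h.apply_of_ne hka hk
    · exact h.apply_of_ne hk hka
  have hblk : g ((w * swap i j) a) = g ((w * swap i j) (y b)) := by rw [hwa, hwk, hbk]
  have hyb : y b = y i ∨ y b = y j := by
    rcases hab with ⟨-, rfl⟩ | ⟨-, rfl⟩ <;> simp
  have hzk := hmem (y b) (by tauto) (by rw [hwk, hbk])
  have hdesc := h.atom.desc b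
  have hdesc' := h.atom.desc' (a := b)
  have := h.atom'.on_pair hka.symm hblk (hza.imp_right And.left) (hzk.imp_right And.left)
  rw [hwa, hwk] at this
  rcases lt_or_gt_of_ne hk with h1 | h1
  · have h2 := hdesc' h1
    rcases this with h3 | h3
    · exact Or.inl ⟨hk, by omega, h3.2⟩
    · exact Or.inr ⟨hk, by omega, h3.2⟩
  · have h2 := hdesc h1
    rcases this with h3 | h3
    · exact Or.inl ⟨hk, by omega, h3.2⟩
    · exact Or.inr ⟨hk, by omega, h3.2⟩

theorem block_eq_of_mem_cycles (h : AtomSwap g i j w y z) (hb : g (w i) = g (w j)) {x : Fin n}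
    (hx : x = i ∨ x = j ∨ x = y i ∨ x = y j) : g (w x) = g (w i) := by
  rcases hx with rfl | rfl | rfl | rfl
  · rfl
  · exact hb.symm
  · exact h.atom.blk _
  · rw [h.atom.blk, hb]

theorem apply_of_fixed_fixed [PartialOrder ι] (hg : Monotone g) (h : AtomSwap g i j w y z)
    (hb : g (w i) = g (w j)) (hi : y i = i) (hj : y j = j) : z i = j ∧ z j = i := by
  have h1 := h.cycles_closed hg (x := i) (by simp)
  have h2 := h.cycles_closed hg (x := j) (by simp)
  rw [hi, hj] at h1 h2
  have h3 := h.atom'.on_pair h.lt.ne (by rw [h.apply_left, h.apply_right, hb])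
    (by tauto) (by tauto)
  rw [h.apply_left, h.apply_right] at h3
  have := h.lt
  have := h.pos
  omega

/-- The involution obtained by a swap depends only on the given involution and the blocks. -/
theorem unique [PartialOrder ι] (hg : Monotone g) {w₁ w₂ z₁ z₂ : Perm (Fin n)} (h₁ : AtomSwap g i j w₁ y z₁)
    (h₂ : AtomSwap g i j w₂ y z₂) (hb : ∀ x, g (w₁ x) = g (w₂ x)) : z₁ = z₂ := by
  have hy := h₁.atom.invol
  have hlt := h₁.lt
  suffices H : ∀ x, x = i ∨ x = j ∨ x = y i ∨ x = y j → z₁ x = z₂ x by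
    ext1 x
    by_cases hx : x = i ∨ x = j ∨ x = y i ∨ x = y j
    · exact H x hx
    · push Not at hx
      have hi : y x ≠ i := fun e => hx.2.2.1 (by rw [← e, hy])
      have hj : y x ≠ j := fun e => hx.2.2.2 (by rw [← e, hy])
      rw [h₁.apply_eq hg hx.1 hx.2.1 hi hj, h₂.apply_eq hg hx.1 hx.2.1 hi hj]
  by_cases hbk : g (w₁ i) = g (w₁ j)
  swap
  · have hbk₂ : g (w₂ i) ≠ g (w₂ j) := by rwa [← hb, ← hb]
    have key : ∀ a b, (a = i ∧ b = j) ∨ (a = j ∧ b = i) →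
        z₁ a = z₂ a ∧ (y b ≠ b → z₁ (y b) = z₂ (y b)) := by
      intro a b hab
      have e₁ := h₁.apply_of_block_ne hg hab hbk
      have e₂ := h₂.apply_of_block_ne hg hab hbk₂
      clear h₁ h₂
      omega
    have k₁ := key i j (Or.inl ⟨rfl, rfl⟩)
    have k₂ := key j i (Or.inr ⟨rfl, rfl⟩)
    rintro x (rfl | rfl | rfl | rfl)
    · exact k₁.1
    · exact k₂.1
    · by_cases e : y i = i
      · rw [e]; exact k₁.1
      · exact k₂.2 e
    · by_cases e : y j = j
      · rw [e]; exact k₂.1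
      · exact k₁.2 e
  have hbk₂ : g (w₂ i) = g (w₂ j) := by rwa [← hb, ← hb]
  have hbl₁ : ∀ {x x'}, (x = i ∨ x = j ∨ x = y i ∨ x = y j) →
      (x' = i ∨ x' = j ∨ x' = y i ∨ x' = y j) → g (w₁ x) = g (w₁ x') := fun h h' => by
    rw [h₁.block_eq_of_mem_cycles hbk h, h₁.block_eq_of_mem_cycles hbk h']
  have hbl₂ : ∀ {x x'}, (x = i ∨ x = j ∨ x = y i ∨ x = y j) →
      (x' = i ∨ x' = j ∨ x' = y i ∨ x' = y j) → g (w₂ x) = g (w₂ x') := fun h h' => by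
    rw [← hb, ← hb]; exact hbl₁ h h'
  have hyC : ∀ x, (x = i ∨ x = j ∨ x = y i ∨ x = y j) →
      (y x = i ∨ y x = j ∨ y x = y i ∨ y x = y j) := by
    rintro x (rfl | rfl | rfl | rfl) <;> simp [hy]
  have hkj := h₁.apply_ne
  have hli : y j ≠ i := fun e => hkj (by rw [← e, hy])
  have hkl : y i ≠ y j := y.injective.ne hlt.ne
  have hcl₁ := fun x => h₁.cycles_closed hg (x := x)
  have hcl₂ := fun x => h₂.cycles_closed hg (x := x)
  -- Exactly one of `i`, `j` is fixed by `y`, and `c` is the partner of the other.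
  have three : ∀ c, c ≠ i → c ≠ j → (∀ x, x = i ∨ x = j ∨ x = y i ∨ x = y j ↔
      x = i ∨ x = j ∨ x = c) → (y i = i → y j ≠ j) →
      ∀ x, x = i ∨ x = j ∨ x = y i ∨ x = y j → z₁ x = z₂ x := by
    intro c hci hcj hC hfix
    obtain ⟨p, q, r, hpq, hqr, hmem⟩ := exists_sorted_of_card_eq_three (C := {i, j, c})
      (Finset.card_eq_three.2 ⟨i, j, c, hlt.ne, hci.symm, hcj.symm, rfl⟩)
    simp only [Finset.mem_insert, Finset.mem_singleton] at hmem
    simp only [← hC] at hmem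
    have mp := (hmem p).2 (by simp)
    have mq := (hmem q).2 (by simp)
    have mr := (hmem r).2 (by simp)
    have mi := (hmem i).1 (by simp)
    have mj := (hmem j).1 (by simp)
    simp only [hmem] at hyC hcl₁ hcl₂
    have e₁ := h₁.apply_on_three hpq hqr mi mj hyC hcl₁ (hbl₁ mp mq) (hbl₁ mq mr) hfix
    have e₂ := h₂.apply_on_three hpq hqr mi mj hyC hcl₂ (hbl₂ mp mq) (hbl₂ mq mr) hfix
    intro x hx
    rcases (hmem x).1 hx with rfl | rfl | rfl
    · rw [e₁.1, e₂.1]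
    · rw [e₁.2.1, e₂.2.1]
    · rw [e₁.2.2, e₂.2.2]
  by_cases hi : y i = i
  · by_cases hj : y j = j
    · have e₁ := h₁.apply_of_fixed_fixed hg hbk hi hj
      have e₂ := h₂.apply_of_fixed_fixed hg hbk₂ hi hj
      rw [hi, hj]
      rintro x (rfl | rfl | rfl | rfl)
      · rw [e₁.1, e₂.1]
      · rw [e₁.2, e₂.2]
      · rw [e₁.1, e₂.1]
      · rw [e₁.2, e₂.2]
    · exact three (y j) hli hj (fun x => by rw [hi]; tauto) (fun _ => hj)
  · by_cases hj : y j = j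
    · exact three (y i) hi hkj (fun x => by rw [hj]; tauto) (fun e => absurd e hi)
    · have hcard : ({i, j, y i, y j} : Finset (Fin n)).card = 4 := by
        rw [Finset.card_insert_of_notMem, Finset.card_insert_of_notMem,
          Finset.card_pair hkl]
        · simpa using ⟨Ne.symm hkj, Ne.symm hj⟩
        · simpa using ⟨hlt.ne, Ne.symm hi, Ne.symm hli⟩
      obtain ⟨p, q, r, s, hpq, hqr, hrs, hmem⟩ := exists_sorted_of_card_eq_four hcard
      simp only [Finset.mem_insert, Finset.mem_singleton] at hmem
      have hfix : ∀ x, x = i ∨ x = j ∨ x = y i ∨ x = y j → y x ≠ x := by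
        rintro x (rfl | rfl | rfl | rfl)
        · exact hi
        · exact hj
        · rw [hy]; exact Ne.symm hi
        · rw [hy]; exact Ne.symm hj
      have mp := (hmem p).2 (by simp)
      have mq := (hmem q).2 (by simp)
      have mr := (hmem r).2 (by simp)
      have ms := (hmem s).2 (by simp)
      have mi := (hmem i).1 (by simp)
      have mj := (hmem j).1 (by simp)
      simp only [hmem] at hyC hcl₁ hcl₂
      have e₁ := h₁.apply_on_four hpq hqr hrs mi mj hyC hcl₁ (hbl₁ mp mq) (hbl₁ mq mr)
        (hbl₁ mr ms) (hfix p mp) (hfix q mq) (hfix r mr) hkj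
      have e₂ := h₂.apply_on_four hpq hqr hrs mi mj hyC hcl₂ (hbl₂ mp mq) (hbl₂ mq mr)
        (hbl₂ mr ms) (hfix p mp) (hfix q mq) (hfix r mr) hkj
      have e : z₁ p = z₂ p ∧ z₁ q = z₂ q ∧ z₁ r = z₂ r ∧ z₁ s = z₂ s := by
        clear hmem hcl₁ hcl₂ hyC mi mj mp mq mr ms three
        rcases e₁ with e₁ | ⟨c₁, e₁, e₁', d₁ | d₁⟩ <;>
        rcases e₂ with e₂ | ⟨c₂, e₂, e₂', d₂ | d₂⟩ <;> omega
      intro x hx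
      rcases (hmem x).1 hx with rfl | rfl | rfl | rfl
      · exact e.1
      · exact e.2.1
      · exact e.2.2.1
      · exact e.2.2.2

end AtomSwap

/-! ### Uniqueness of the target and the operator. -/

theorem exists_atomSwap {n : ℕ} {μ : Composition n} {i j : Fin n} (hij : i < j)
    {π σ v U y : Perm (Fin n)} (hB : BlockForm μ π U y) (hv : v ∈ muAtoms μ π)
    (hc : BruhatCover v (v * swap i j)) (hσ : v * swap i j ∈ muAtoms μ σ) :
    ∃ U' z, BlockForm μ σ U' z ∧ AtomSwap μ.index i j v y z ∧
      (∀ x, μ.index (v x) = μ.index (U x)) ∧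
      ∀ x, μ.index (U' x) = μ.index (U (swap i j x)) := by
  obtain ⟨U₁, y₁, hB₁, hU₁, hP₁⟩ := exists_blockForm_of_mem_muAtoms hv
  obtain ⟨U', z, hB', hU', hP'⟩ := exists_blockForm_of_mem_muAtoms hσ
  obtain rfl := hB.unique hB₁
  have hU : ∀ x, μ.index (v x) = μ.index (U x) := fun x => by
    rw [← hU₁, ← hB₁.blockOf_eq, ← hB.blockOf_eq]
  exact ⟨U', z, hB', ⟨hij, lt_of_bruhatCover_swap hij hc,
    fun a h1 h2 => not_between_of_bruhatCover_swap hc h1 h2, hP₁, hP'⟩, hU,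
    fun x => by rw [hU', ← hU, Perm.mul_apply]⟩

/-- Both targets have the same involution, by `AtomSwap.unique`, and the same blocks of letters,
those of `π` with `i` and `j` exchanged; these recover the permutation. -/
theorem target_unique {n : ℕ} {μ : Composition n} {i j : Fin n} {π σ τ u v : Perm (Fin n)}
    (hu : u ∈ muAtoms μ π) (hv : v ∈ muAtoms μ π) (hcu : BruhatCover u (u * swap i j))
    (hcv : BruhatCover v (v * swap i j)) (hσ : u * swap i j ∈ muAtoms μ σ)
    (hτ : v * swap i j ∈ muAtoms μ τ) : σ = τ := by
  wlog hij : i < j generalizing i j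
  -- For `i = j` there is no cover, since `t_ii = e` keeps the length.
  · rcases eq_or_lt_of_le (not_lt.1 hij) with rfl | hji
    · have := hcu.2
      rw [swap_self, ← Perm.one_def, mul_one] at this
      omega
    · rw [swap_comm] at hcu hcv hσ hτ
      exact this hcu hcv hσ hτ hji
  obtain ⟨U, y, hB, -, -⟩ := exists_blockForm_of_mem_muAtoms hu
  obtain ⟨U₁, z₁, hB₁, hS₁, hb₁, hU₁⟩ := exists_atomSwap hij hB hu hcu hσ
  obtain ⟨U₂, z₂, hB₂, hS₂, hb₂, hU₂⟩ := exists_atomSwap hij hB hv hcv hτ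
  obtain rfl := hS₁.unique (index_monotone μ) hS₂ fun x => by rw [hb₁, hb₂]
  exact hB₁.ext hB₂ fun a => by rw [hU₁, hU₂]

theorem isTransposeValue_existsUnique {n : ℕ} (μ : Composition n) (i j : Fin n)
    (π : muInvolutions μ) : ∃! τ : muInvolutions μ, IsTransposeValue μ i j π τ := by
  by_cases h : ∃ σ : muInvolutions μ, AtomCover μ i j π.1 σ.1
  · obtain ⟨σ, hσ⟩ := h
    refine ⟨σ, Or.inl hσ, fun τ hτ => ?_⟩
    rcases hτ with hτ | ⟨hτ, -⟩
    · obtain ⟨u, hu, hcu, hu'⟩ := hσ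
      obtain ⟨v, hv, hcv, hv'⟩ := hτ
      exact Subtype.ext (target_unique hv hu hcv hcu hv' hu')
    · exact absurd ⟨σ, hσ⟩ hτ
  · refine ⟨π, Or.inr ⟨h, rfl⟩, fun τ hτ => ?_⟩
    rcases hτ with hτ | ⟨-, hτ⟩
    · exact absurd ⟨τ, hτ⟩ h
    · exact hτ

end MuInv

theorem lemma3p8 {n : ℕ} (μ : Composition n) (i j : Fin n) :
    (∃! T : MuInv.muInvolutions μ → MuInv.muInvolutions μ,
      ∀ π τ : MuInv.muInvolutions μ, MuInv.IsTransposeValue μ i j π τ ↔ T π = τ) ∧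
    (∀ π σ τ : MuInv.muInvolutions μ, ∀ u ∈ MuInv.muAtoms μ π.1, ∀ v ∈ MuInv.muAtoms μ π.1,
      MuInv.BruhatCover u (u * Equiv.swap i j) → MuInv.BruhatCover v (v * Equiv.swap i j) →
      u * Equiv.swap i j ∈ MuInv.muAtoms μ σ.1 → v * Equiv.swap i j ∈ MuInv.muAtoms μ τ.1 →
      σ = τ) := by
  refine ⟨?_, fun π σ τ u hu v hv hcu hcv hσ hτ =>
    Subtype.ext (MuInv.target_unique hu hv hcu hcv hσ hτ)⟩
  choose T hT hT' using MuInv.isTransposeValue_existsUnique μ i j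
  refine ⟨T, fun π τ => ⟨fun h => (hT' π τ h).symm, fun h => h ▸ hT π⟩, fun T' h => ?_⟩
  exact funext fun π => hT' π _ ((h π _).2 rfl)
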